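/- Let $k$ be an algebraically closed field and $X$ a $k$-scheme; $\mathrm{Coh}(X)$ is the category of coherent $\mathcal O_X$-modules. All functors between $k$-linear categories are $k$-linear. **The category $\widetilde{\mathrm{Fin}}_n$.** Its objects are the essentially small $k$-linear abelian categories $\mathcal A$ in which every object has finite length, all $\mathrm{Hom}_{\mathcal A}(M,M')$ and $\mathrm{Ext}^1_{\mathcal A}(M,M')$ are finite dimensional over $k$ (condition $(\dagger)$), and there are exactly $n$ isomorphism classes of simple objects, put in a linear order and represented by $S_1^{\mathcal A},\dots,S_n^{\mathcal A}$. Let $i_{\mathcal A}\colon (\mathrm{mod}_{\mathrm{fd}}\text{-}k)^{\oplus n}\to\mathcal A$, $(V_i)\mapsto\bigoplus_i V_i\otimes S_i^{\mathcal A}$, be the inclusion of the semisimple objects, with left adjoint $i_{\mathcal A}^*$. A morphism $\mathcal A\to\mathcal B$ is an exact functor $\Psi$ taking $S_i^{\mathcal A}$ to $S_i^{\mathcal B}$ for all $i$, with a given identification $\sigma\colon\Psi i_{\mathcal A}\simeq i_{\mathcal B}$; pairs $(\Psi,\sigma)$ are considered up to isomorphisms of functors compatible with the identifications. **The functor $\underline{\mathrm{ncDef}}$.**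 Let $F_1,\dots,F_n\in\mathrm{Coh}(X)$ and $i_0\colon(\mathrm{mod}_{\mathrm{fd}}\text{-}k)^{\oplus n}\to\mathrm{Coh}(X)$, $(V_i)\mapsto\bigoplus_i V_i\otimes F_i$. For $\mathcal A\in\widetilde{\mathrm{Fin}}_n$, $\underline{\mathrm{ncDef}}_{F_1,\dots,F_n}(\mathcal A)$ is the set of pairs $(T,\varphi)$ with $T\colon\mathcal A\to\mathrm{Coh}(X)$ exact and $\varphi\colon T\to i_0 i_{\mathcal A}^*$ a morphism of functors such that $\varphi i_{\mathcal A}$ is an isomorphism, modulo $(T,\varphi)\sim(T',\varphi')$ if there is an isomorphism $\gamma\colon T\simeq T'$ with $\varphi'\gamma=\varphi$. A morphism $(\Psi,\sigma)\colon\mathcal A\to\mathcal B$ acts by $(T,\varphi)\mapsto\bigl(T\Psi,\ T\Psi\xrightarrow{\varphi\Psi}i_0i_{\mathcal B}^*\Psi\xrightarrow{i_0\gamma}i_0i_{\mathcal A}^*\bigr)$, where $\gamma\colon i_{\mathcal B}^*\Psi\to i_{\mathcal A}^*$ is adjoint to $\Psi\to\Psi i_{\mathcal A}i_{\mathcal A}^*\xrightarrow{\sigma}i_{\mathcal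 B}i_{\mathcal A}^*$. **Theorem.** Let $F_1,\dots,F_n\in\mathrm{Coh}(X)$ be a simple collection, i.e. $\dim_k\mathrm{Hom}_X(F_i,F_j)=\delta_{ij}$, with $\dim_k\mathrm{Ext}^1_X(F_i,F_j)<\infty$ for all $i,j$. Let $\mathcal F(\{F_i\})\subset\mathrm{Coh}(X)$ be the full subcategory of the sheaves with a finite filtration whose subquotients are finite direct sums of sheaves $F_i$. Then $\mathcal F(\{F_i\})$ is abelian and, with the simple objects $F_1,\dots,F_n$ in this order, is an object of $\widetilde{\mathrm{Fin}}_n$; and it ind-represents $\underline{\mathrm{ncDef}}_{F_1,\dots,F_n}$: there is an isomorphism of functors on $\widetilde{\mathrm{Fin}}_n^{\mathrm{op}}$ (hence also on its full subcategory of categories with a projective generator) $$\eta\colon\mathrm{Hom}_{\widetilde{\mathrm{Fin}}_n}(-,\mathcal F(\{F_i\}))\simeq\underline{\mathrm{ncDef}}_{F_1,\dots,F_n}(-).$$ Moreover, $\eta$ can be chosen so that two morphisms $(\Psi,\sigma),(\Psi',\sigma')\colon\mathcal A\to\mathcal F(\{F_i\})$ have isomorphic underlying functors $\Psi\simeq\Psi'$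 if and only if their images under $\eta$ lie in the same orbit of $\mathrm{Aut}(i_0)$, acting by $\alpha\cdot[(T,\varphi)]=[(T,\alpha\varphi)]$. -/

import Mathlib

open CategoryTheory Limits

universe w v u

namespace NCDef

noncomputable section

section DirectSums

variable {k : Type v} [Field k]

section Preadd

variable {C : Type u} [Category.{v} C] [Preadditive C] [Linear k C] [HasFiniteBiproducts C]

/-- `V ⊗ G`: the direct sum of `dim V` copies of `G`. -/
abbrev tensObj (V : FGModuleCat.{v} k) (G : C) : C :=
  ⨁ fun _ : Fin (Module.finrank k V) => G

/-- `f ⊗ G`: the morphism given by the matrix of `f`. -/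
def tensMap {V W : FGModuleCat.{v} k} (f : V ⟶ W) (G : C) : tensObj V G ⟶ tensObj W G :=
  biproduct.matrix fun a b =>
    LinearMap.toMatrix (Module.finBasis k V) (Module.finBasis k W) f.hom.hom b a • 𝟙 G

lemma tensMap_id (V : FGModuleCat.{v} k) (G : C) : tensMap (𝟙 V) G = 𝟙 _ := by
  classical
  apply biproduct.hom_ext
  intro b
  apply biproduct.hom_ext'
  intro a
  by_cases h : a = b
  · subst h
    simp [tensMap]
  · simp [tensMap, Matrix.one_apply, biproduct.ι_π_ne _ h, Ne.symm h]

@[simp]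
lemma tensMap_π {V W : FGModuleCat.{v} k} (f : V ⟶ W) (G : C) (b) :
    tensMap f G ≫ biproduct.π (fun _ => G) b = ∑ a, LinearMap.toMatrix (Module.finBasis k V)
      (Module.finBasis k W) f.hom.hom b a • biproduct.π (fun _ => G) a := by
  classical
  apply biproduct.hom_ext'
  intro a
  simp [tensMap, Preadditive.comp_sum, biproduct.ι_π]

lemma tensMap_comp {V W U : FGModuleCat.{v} k} (f : V ⟶ W) (g : W ⟶ U) (G : C) :
    tensMap (f ≫ g) G = tensMap f G ≫ tensMap g G := by
  apply biproduct.hom_ext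
  intro b
  rw [Category.assoc, tensMap_π, tensMap_π, Preadditive.comp_sum]
  simp only [Linear.comp_smul, tensMap_π, Finset.smul_sum, smul_smul]
  rw [Finset.sum_comm]
  refine Finset.sum_congr rfl fun c _ => ?_
  rw [FGModuleCat.hom_hom_comp, LinearMap.toMatrix_comp _ (Module.finBasis k W) _,
    Matrix.mul_apply, Finset.sum_smul]

/-- The `k`-linear functor `(mod_fd k)^n ⥤ C`, `(V_i) ↦ ⨁ V_i ⊗ G_i`, sending the `i`-th
simple object to `G i`. -/
def sumFunctor {n : ℕ} (G : Fin n → C) : ((_ : Fin n) → FGModuleCat.{v} k) ⥤ C where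
  obj V := ⨁ fun i => tensObj (V i) (G i)
  map f := biproduct.map fun i => tensMap (f i) (G i)
  map_id V := by
    apply biproduct.hom_ext
    intro b
    simp [tensMap_id]
  map_comp f g := by
    apply biproduct.hom_ext
    intro b
    simp [tensMap_comp]

variable {n : ℕ} (G : Fin n → C)

/-- The projection of `⨁ V_i ⊗ G_i` to the `a`-th copy of `G i`. -/
def sumProj (V : (_ : Fin n) → FGModuleCat.{v} k) (i : Fin n) (a : Fin (Module.finrank k (V i))) :
    (sumFunctor (k := k) G).obj V ⟶ G i :=
  biproduct.π (fun i => tensObj (V i) (G i)) i ≫ biproduct.π (fun _ => G i) a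

/-- The inclusion of the `a`-th copy of `G i` into `⨁ V_i ⊗ G_i`. -/
def sumIncl (V : (_ : Fin n) → FGModuleCat.{v} k) (i : Fin n) (a : Fin (Module.finrank k (V i))) :
    G i ⟶ (sumFunctor (k := k) G).obj V :=
  biproduct.ι (fun _ => G i) a ≫ biproduct.ι (fun i => tensObj (V i) (G i)) i

variable {G} in
lemma sum_hom_ext {M : C} {V : (_ : Fin n) → FGModuleCat.{v} k}
    {f g : M ⟶ (sumFunctor (k := k) G).obj V}
    (h : ∀ i a, f ≫ sumProj G V i a = g ≫ sumProj G V i a) : f = g := by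
  apply biproduct.hom_ext
  intro i
  apply biproduct.hom_ext
  intro a
  exact (Category.assoc _ _ _).trans ((h i a).trans (Category.assoc _ _ _).symm)

variable {G} in
lemma sum_hom_ext' {M : C} {V : (_ : Fin n) → FGModuleCat.{v} k}
    {f g : (sumFunctor (k := k) G).obj V ⟶ M}
    (h : ∀ i a, sumIncl G V i a ≫ f = sumIncl G V i a ≫ g) : f = g := by
  apply biproduct.hom_ext'
  intro i
  apply biproduct.hom_ext'
  intro a
  exact (Category.assoc _ _ _).symm.trans ((h i a).trans (Category.assoc _ _ _))

lemma sumFunctor_map_proj {V W : (_ : Fin n) → FGModuleCat.{v} k} (f : V ⟶ W) (i b) :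
    (sumFunctor (k := k) G).map f ≫ sumProj G W i b =
      ∑ a, LinearMap.toMatrix (Module.finBasis k (V i)) (Module.finBasis k (W i))
        (f i).hom.hom b a • sumProj G V i a := by
  have h : (biproduct.map fun i => tensMap (f i) (G i)) ≫
      biproduct.π (fun i => tensObj (W i) (G i)) i ≫ biproduct.π (fun _ => G i) b =
      ∑ a, LinearMap.toMatrix (Module.finBasis k (V i)) (Module.finBasis k (W i))
        (f i).hom.hom b a •
          (biproduct.π (fun i => tensObj (V i) (G i)) i ≫ biproduct.π (fun _ => G i) a) := by
    simp [Preadditive.comp_sum]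
  exact h

variable [∀ (M : C) (i : Fin n), Module.Finite k (M ⟶ G i)]

/-- The object `(Hom(M, G_i)^*)_i`. -/
abbrev dualHom (M : C) : (_ : Fin n) → FGModuleCat.{v} k :=
  fun i => FGModuleCat.of k (Module.Dual k (M ⟶ G i))

/-- The `(i, a)`-th component of the morphism corresponding to `f` is the morphism `M ⟶ G i`
which gives, by evaluation, the functional `coord_a ∘ f_i` on `Hom(M, G i)^*`. -/
def sumFunctorHom (M : C) (V : (_ : Fin n) → FGModuleCat.{v} k) (f : dualHom G M ⟶ V) :
    M ⟶ (sumFunctor (k := k) G).obj V :=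
  biproduct.lift (f := fun i => tensObj (V i) (G i)) fun i =>
    biproduct.lift (f := fun _ => G i) fun a =>
      (Module.evalEquiv k (M ⟶ G i)).symm ((Module.finBasis k (V i)).coord a ∘ₗ (f i).hom.hom)

lemma apply_sumFunctorHom (M : C) (V : (_ : Fin n) → FGModuleCat.{v} k) (f : dualHom G M ⟶ V)
    (i a) (ξ : Module.Dual k (M ⟶ G i)) :
    ξ (sumFunctorHom G M V f ≫ sumProj G V i a) =
      (Module.finBasis k (V i)).coord a ((f i).hom.hom ξ) := by
  have h1 : sumFunctorHom G M V f ≫ sumProj G V i a =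
      (Module.evalEquiv k (M ⟶ G i)).symm
        ((Module.finBasis k (V i)).coord a ∘ₗ (f i).hom.hom) := by
    refine (biproduct.lift_π_assoc (f := fun i => tensObj (V i) (G i)) _ _ _).trans ?_
    exact biproduct.lift_π (f := fun _ => G i) _ _
  have h2 (y : Module.Dual k (Module.Dual k (M ⟶ G i))) :
      Module.Dual.eval k (M ⟶ G i) ((Module.evalEquiv k (M ⟶ G i)).symm y) = y :=
    (Module.evalEquiv k (M ⟶ G i)).apply_symm_apply y
  rw [h1]
  exact LinearMap.congr_fun (h2 ((Module.finBasis k (V i)).coord a ∘ₗ (f i).hom.hom)) ξ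

variable {G} in
lemma sum_hom_ext_dual {M : C} {V : (_ : Fin n) → FGModuleCat.{v} k}
    {f g : M ⟶ (sumFunctor (k := k) G).obj V}
    (h : ∀ i a (ξ : Module.Dual k (M ⟶ G i)),
      ξ (f ≫ sumProj G V i a) = ξ (g ≫ sumProj G V i a)) : f = g :=
  sum_hom_ext fun i a => (Module.evalEquiv k (M ⟶ G i)).injective (LinearMap.ext (h i a))

/-- Morphisms `(Hom(M, G_i)^*)_i ⟶ V` correspond to morphisms `M ⟶ ⨁ V_i ⊗ G_i`. -/
def sumFunctorHomEquiv (M : C) (V : (_ : Fin n) → FGModuleCat.{v} k) :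
    (dualHom G M ⟶ V) ≃ (M ⟶ (sumFunctor (k := k) G).obj V) where
  toFun := sumFunctorHom G M V
  invFun g i := FGModuleCat.ofHom (∑ a, LinearMap.smulRight
    (Module.Dual.eval k (M ⟶ G i) (g ≫ sumProj G V i a)) (Module.finBasis k (V i) a))
  left_inv f := by
    funext i
    apply FGModuleCat.hom_ext
    refine LinearMap.ext fun ξ => ?_
    refine Eq.trans ?_ ((Module.finBasis k (V i)).sum_repr ((f i).hom.hom ξ))
    refine (LinearMap.sum_apply _ _ _).trans (Finset.sum_congr rfl fun a _ => ?_)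
    exact congrArg (fun t : k => t • Module.finBasis k (V i) a) (apply_sumFunctorHom G M V f i a ξ)
  right_inv g := by
    refine sum_hom_ext_dual fun i a ξ => ?_
    rw [apply_sumFunctorHom]
    refine (congrArg ((Module.finBasis k (V i)).coord a) (LinearMap.sum_apply _ _ _)).trans ?_
    classical
    simp [Finsupp.single_apply]

lemma sumFunctorHomEquiv_naturality (M : C) (V W : (_ : Fin n) → FGModuleCat.{v} k)
    (h : V ⟶ W) (g : dualHom G M ⟶ V) :
    sumFunctorHomEquiv G M W (g ≫ h) =
      sumFunctorHomEquiv G M V g ≫ (sumFunctor (k := k) G).map h := by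
  refine sum_hom_ext_dual fun i a ξ => ?_
  refine (apply_sumFunctorHom G M W (g ≫ h) i a ξ).trans ?_
  rw [Category.assoc, sumFunctor_map_proj, Preadditive.comp_sum, map_sum]
  have := congrFun (LinearMap.toMatrix_mulVec_repr (Module.finBasis k (V i))
    (Module.finBasis k (W i)) (h i).hom.hom ((g i).hom.hom ξ)) a
  refine this.symm.trans ((?_ : (∑ b, LinearMap.toMatrix (Module.finBasis k (V i))
    (Module.finBasis k (W i)) (h i).hom.hom a b * (Module.finBasis k (V i)).repr
      ((g i).hom.hom ξ) b) = _))
  refine Finset.sum_congr rfl fun b _ => ?_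
  rw [Linear.comp_smul, map_smul]
  exact congrArg _ (apply_sumFunctorHom G M V g i b ξ).symm

/-- The left adjoint `M ↦ (Hom(M, G_i)^*)_i` of `V ↦ ⨁ V_i ⊗ G_i`. -/
def topFunctor : C ⥤ ((_ : Fin n) → FGModuleCat.{v} k) :=
  Adjunction.leftAdjointOfEquiv (sumFunctorHomEquiv (k := k) G) (sumFunctorHomEquiv_naturality G)

/-- The adjunction. -/
def topAdj : topFunctor (k := k) G ⊣ sumFunctor G :=
  Adjunction.adjunctionOfEquivLeft _ _

lemma sumIncl_proj {n : ℕ} (G : Fin n → C) (V : (_ : Fin n) → FGModuleCat.{v} k) (i a b) :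
    sumIncl G V i a ≫ sumProj G V i b = (if a = b then 1 else 0 : k) • 𝟙 (G i) := by
  have h : (biproduct.ι (fun _ => G i) a ≫ biproduct.ι (fun i => tensObj (V i) (G i)) i) ≫
      biproduct.π (fun i => tensObj (V i) (G i)) i ≫ biproduct.π (fun _ => G i) b =
      (if a = b then 1 else 0 : k) • 𝟙 (G i) := by
    by_cases hab : a = b
    · subst hab; simp
    · simp [hab, biproduct.ι_π_ne _ hab]
  exact h

lemma sumIncl_proj_ne {n : ℕ} (G : Fin n → C) (V : (_ : Fin n) → FGModuleCat.{v} k) {i j}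
    (h : i ≠ j) (a b) : sumIncl G V i a ≫ sumProj G V j b = 0 := by
  have h : (biproduct.ι (fun _ => G i) a ≫ biproduct.ι (fun i => tensObj (V i) (G i)) i) ≫
      biproduct.π (fun i => tensObj (V i) (G i)) j ≫ biproduct.π (fun _ => G j) b = 0 := by
    rw [Category.assoc, biproduct.ι_π_ne_assoc _ h, zero_comp, comp_zero]
  exact h

lemma sum_comp_incl_proj {n : ℕ} (G : Fin n → C) (V : (_ : Fin n) → FGModuleCat.{v} k) {M : C}
    (x : ∀ i, Fin (Module.finrank k (V i)) → (M ⟶ G i)) (j b) :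
    (∑ i, ∑ a, x i a ≫ sumIncl G V i a) ≫ sumProj G V j b = x j b := by
  simp only [Preadditive.sum_comp, Category.assoc]
  rw [Finset.sum_eq_single j, Finset.sum_eq_single b]
  · simp [sumIncl_proj]
  · intro a _ h
    simp [sumIncl_proj, h]
  · simp
  · intro i _ h
    simp [sumIncl_proj_ne G V h]
  · simp

lemma sum_total {n : ℕ} (G : Fin n → C) (V : (_ : Fin n) → FGModuleCat.{v} k) :
    ∑ i, ∑ a, sumProj G V i a ≫ sumIncl G V i a = 𝟙 ((sumFunctor G).obj V) :=
  sum_hom_ext fun j b => by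
    rw [sum_comp_incl_proj G V (fun i a => sumProj G V i a), Category.id_comp]

/-- A `k`-linear functor `Ψ` with `Ψ(G_i) ≅ H_i` for all `i` satisfies
`Ψ(⨁ V_i ⊗ G_i) ≅ ⨁ V_i ⊗ H_i`, naturally in `V`. -/
def sumFunctorCompIso {D : Type u} [Category.{v} D] [Preadditive D] [Linear k D]
    [HasFiniteBiproducts D] {n : ℕ} (G : Fin n → C) (H : Fin n → D) (Ψ : C ⥤ D)
    [Ψ.Additive] [Ψ.Linear k] (e : ∀ i, Ψ.obj (G i) ≅ H i) :
    sumFunctor (k := k) G ⋙ Ψ ≅ sumFunctor H :=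
  NatIso.ofComponents
    (fun V =>
      { hom := ∑ i, ∑ a, (Ψ.map (sumProj G V i a) ≫ (e i).hom) ≫ sumIncl H V i a
        inv := ∑ i, ∑ a, sumProj H V i a ≫ (e i).inv ≫ Ψ.map (sumIncl G V i a)
        hom_inv_id := by
          rw [Preadditive.comp_sum]
          simp only [Preadditive.comp_sum, ← Category.assoc]
          simp only [sum_comp_incl_proj H V fun i a => Ψ.map (sumProj G V i a) ≫ (e i).hom]
          simp only [Category.assoc, Iso.hom_inv_id_assoc, ← Functor.map_comp, ← Functor.map_sum,
            sum_total]
          exact Ψ.map_id _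
        inv_hom_id := by
          refine sum_hom_ext fun j b => ?_
          rw [Category.assoc, sum_comp_incl_proj H V fun i a => Ψ.map (sumProj G V i a) ≫ (e i).hom,
            Category.id_comp]
          simp only [Preadditive.sum_comp, Category.assoc, ← Functor.map_comp_assoc]
          rw [Finset.sum_eq_single j, Finset.sum_eq_single b]
          · simp [sumIncl_proj]
          · intro a _ h
            simp [sumIncl_proj, h]
          · simp
          · intro i _ h
            simp [sumIncl_proj_ne G V h]
          · simp })
    (fun {V W} f => by
      refine sum_hom_ext fun j b => ?_
      dsimp only [Functor.comp_obj, Functor.comp_map]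
      rw [Category.assoc, sum_comp_incl_proj H W fun i a => Ψ.map (sumProj G W i a) ≫ (e i).hom,
        ← Functor.map_comp_assoc, Category.assoc, sumFunctor_map_proj, sumFunctor_map_proj,
        Preadditive.comp_sum, Functor.map_sum, Preadditive.sum_comp]
      refine Finset.sum_congr rfl fun a _ => ?_
      rw [Linear.comp_smul,
        sum_comp_incl_proj H V fun i a => Ψ.map (sumProj G V i a) ≫ (e i).hom,
        Functor.map_smul, Linear.smul_comp])

lemma sumIncl_map_proj {n : ℕ} (G : Fin n → C) {V W : (_ : Fin n) → FGModuleCat.{v} k}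
    (f : V ⟶ W) (i a b) :
    sumIncl G V i a ≫ (sumFunctor G).map f ≫ sumProj G W i b =
      LinearMap.toMatrix (Module.finBasis k (V i)) (Module.finBasis k (W i))
        (f i).hom.hom b a • 𝟙 (G i) := by
  rw [sumFunctor_map_proj, Preadditive.comp_sum]
  simp only [Linear.comp_smul, sumIncl_proj, smul_smul]
  rw [Finset.sum_eq_single a (by simp +contextual [eq_comm]) (by simp)]
  simp

/-- If the `G i` are pairwise orthogonal, nonzero and have only scalar endomorphisms, then
`V ↦ ⨁ V_i ⊗ G_i` is fully faithful. -/
def sumFunctorFullyFaithful {n : ℕ} (G : Fin n → C)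
    (h0 : ∀ i j, i ≠ j → ∀ f : G i ⟶ G j, f = 0)
    (h1 : ∀ i (f : G i ⟶ G i), ∃ c : k, c • 𝟙 (G i) = f)
    (h2 : ∀ i, 𝟙 (G i) ≠ 0) : (sumFunctor (k := k) G).FullyFaithful where
  preimage {V W} g i := FGModuleCat.ofHom (Matrix.toLin (Module.finBasis k (V i))
    (Module.finBasis k (W i)) (Matrix.of fun b a =>
      (h1 i (sumIncl G V i a ≫ g ≫ sumProj G W i b)).choose))
  map_preimage {V W} g := by
    refine sum_hom_ext fun j b => sum_hom_ext' fun i a => ?_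
    by_cases hij : i = j
    · subst hij
      rw [sumIncl_map_proj]
      refine Eq.trans ?_ (h1 i (sumIncl G V i a ≫ g ≫ sumProj G W i b)).choose_spec
      congr 1
      exact congrFun (congrFun (LinearMap.toMatrix_toLin (Module.finBasis k (V i))
        (Module.finBasis k (W i)) _) b) a
    · rw [h0 i j hij (sumIncl G V i a ≫ _ ≫ _), h0 i j hij (sumIncl G V i a ≫ g ≫ _)]
  preimage_map {V W} f := by
    funext i
    apply FGModuleCat.hom_ext
    refine Eq.trans ?_ (Matrix.toLin_toMatrix (Module.finBasis k (V i))
        (Module.finBasis k (W i)) _)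
    refine congrArg (Matrix.toLin (Module.finBasis k (V i)) (Module.finBasis k (W i))) ?_
    ext b a
    have h := (h1 i (sumIncl G V i a ≫ (sumFunctor G).map f ≫ sumProj G W i b)).choose_spec
    rw [sumIncl_map_proj] at h
    have h3 := sub_eq_zero.2 h
    rw [← sub_smul] at h3
    have := (smul_eq_zero.1 h3).resolve_right (h2 i)
    rw [Matrix.of_apply]
    refine Eq.trans ?_ (sub_eq_zero.1 this)
    congr! 3
    exact sumIncl_map_proj G f i a b

end Preadd
end DirectSums

section Dagger

attribute [local instance] Abelian.hasFiniteBiproducts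

/-- A preadditive category is abelian. -/
structure IsAbelianCat (C : Type u) [Category.{v} C] [Preadditive C] : Prop where
  hasFiniteProducts : HasFiniteProducts C
  hasKernels : HasKernels C
  hasCokernels : HasCokernels C
  normalMono : IsNormalMonoCategory C
  normalEpi : IsNormalEpiCategory C

/-- The abelian structure extending the given preadditive structure. -/
abbrev IsAbelianCat.abelian {C : Type u} [Category.{v} C] [P : Preadditive C]
    (h : IsAbelianCat C) : Abelian C where
  toPreadditive := P
  toIsNormalMonoCategory := h.normalMono
  toIsNormalEpiCategory := h.normalEpi
  has_finite_products := h.hasFiniteProducts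
  has_kernels := h.hasKernels
  has_cokernels := h.hasCokernels

/-- Finite length: there is a finite filtration with simple subquotients. -/
inductive HasFiniteLength {C : Type u} [Category.{v} C] [Abelian C] : C → Prop
  | zero {M : C} : IsZero M → HasFiniteLength M
  | step {S : ShortComplex C} : S.ShortExact → HasFiniteLength S.X₁ → Simple S.X₃ →
      HasFiniteLength S.X₂

/-- `Ext¹(M, N)` is finite dimensional over `k`. -/
def FiniteExtOne (k : Type w) [Field k] {C : Type u} [Category.{v} C] [Abelian C] [Linear k C]
    (M N : C) : Prop :=
  haveI := HasExt.standard C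
  Module.Finite k (Abelian.Ext.{max u v} M N 1)

/-- `C`, with the family `S_1, …, S_n`, is an object of the category `Fin~_n`: it is an essentially
small `k`-linear abelian category, all objects have finite length, `Hom` and `Ext¹` are finite
dimensional, and `S_1, …, S_n` represent the isomorphism classes of simple objects, each one
exactly once (so that the indexing is a linear order on these `n` classes). -/
structure IsFinTilde (k : Type v) [Field k] {C : Type u} [Category.{v} C] [Preadditive C]
    [Linear k C] {n : ℕ} (S : Fin n → C) : Prop where
  essentiallySmall : EssentiallySmall.{v} C
  isAbelian : IsAbelianCat C
  finiteLength : letI := isAbelian.abelian; ∀ M : C, HasFiniteLength M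
  finite_hom : ∀ M N : C, Module.Finite k (M ⟶ N)
  finite_ext : letI := isAbelian.abelian; ∀ M N : C, FiniteExtOne k M N
  simple : ∀ i, Simple (S i)
  injective : ∀ i j, Nonempty (S i ≅ S j) → i = j
  exhaustive : ∀ M : C, Simple M → ∃ i, Nonempty (M ≅ S i)

/-- The objects of `Fin~_n`. -/
structure FinTilde (k : Type u) [Field k] (n : ℕ) where
  carrier : Type (u + 1)
  [category : Category.{u} carrier]
  [preadditive : Preadditive carrier]
  [linear : Linear k carrier]
  S : Fin n → carrier
  isFinTilde : IsFinTilde k S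

namespace FinTilde

variable {k : Type u} [Field k] {n : ℕ}

instance : CoeSort (FinTilde k n) (Type (u + 1)) := ⟨carrier⟩

instance (A : FinTilde k n) : Category.{u} A := A.category

instance (A : FinTilde k n) : Abelian A :=
  @IsAbelianCat.abelian A.carrier A.category A.preadditive
    (@IsFinTilde.isAbelian k _ A.carrier A.category A.preadditive A.linear n A.S A.isFinTilde)

instance (A : FinTilde k n) : Linear k A := A.linear

instance (A : FinTilde k n) (M N : A) : Module.Finite k (M ⟶ N) := A.isFinTilde.finite_hom M N

/-- `(mod_fd k)^n`, which is equivalent to the category `S(A)` of direct sums of copies of the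
simple objects of `A`. -/
abbrev Vect (k : Type u) [Field k] (n : ℕ) := (_ : Fin n) → FGModuleCat.{u} k

/-- The inclusion `i_{S(A)} : S(A) ≃ (mod_fd k)^n ⥤ A`, sending the `i`-th simple object to
`S i`. -/
abbrev incl (A : FinTilde k n) : Vect k n ⥤ A := sumFunctor A.S

/-- The left adjoint `i_{S(A)}^*` of `i_{S(A)}`. -/
abbrev reflect (A : FinTilde k n) : A ⥤ Vect k n := topFunctor A.S

/-- The adjunction `i_{S(A)}^* ⊣ i_{S(A)}`. -/
abbrev adj (A : FinTilde k n) : A.reflect ⊣ A.incl := topAdj A.S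

lemma incl_fullyFaithful [IsAlgClosed k] (A : FinTilde k n) :
    Nonempty A.incl.FullyFaithful := by
  have hS := A.isFinTilde.simple
  refine ⟨sumFunctorFullyFaithful A.S (fun i j hij f => ?_) (fun i f => ?_) (fun i => ?_)⟩
  · by_contra hf
    have := hS i
    have := hS j
    have := isIso_of_hom_simple hf
    exact hij (A.isFinTilde.injective i j ⟨asIso f⟩)
  · have := hS i
    exact endomorphism_simple_eq_smul_id k f
  · have := hS i
    exact id_nonzero _

instance [IsAlgClosed k] (A : FinTilde k n) : A.incl.Full := A.incl_fullyFaithful.some.full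
instance [IsAlgClosed k] (A : FinTilde k n) : A.incl.Faithful := A.incl_fullyFaithful.some.faithful

/-- An exact `k`-linear functor `Ψ : A ⥤ B` taking the `i`-th simple object to the `i`-th simple
object for all `i`, by means of a given identification `σ : Ψ ∘ i_{S(A)} ≅ i_{S(B)}`. (A functor
admits an identification as soon as `Ψ(S_i^A) ≅ S_i^B` for all `i`, see `exists_preHom`.) -/
structure PreHom (A B : FinTilde k n) where
  functor : A ⥤ B
  additive : functor.Additive
  linear : functor.Linear k
  preservesFiniteLimits : PreservesFiniteLimits functor
  preservesFiniteColimits : PreservesFiniteColimits functor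
  σ : A.incl ⋙ functor ≅ B.incl

namespace PreHom
variable {A B C D : FinTilde k n}

/-- Isomorphism of functors, compatible with the identifications. -/
def Rel (p q : PreHom A B) : Prop :=
  ∃ θ : p.functor ≅ q.functor, Functor.whiskerLeft A.incl θ.hom ≫ q.σ.hom = p.σ.hom

lemma rel_iff (p q : PreHom A B) : p.Rel q ↔ ∃ θ : p.functor ≅ q.functor,
    ∀ V, θ.hom.app (A.incl.obj V) ≫ q.σ.hom.app V = p.σ.hom.app V := by
  refine exists_congr fun θ => ⟨fun h V => ?_, fun h => ?_⟩
  · exact NatTrans.congr_app h V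
  · ext V
    exact h V

lemma rel_equivalence (A B : FinTilde k n) : Equivalence (Rel (A := A) (B := B)) where
  refl p := (rel_iff _ _).2 ⟨Iso.refl _, fun V => Category.id_comp _⟩
  symm {p q} h := by
    obtain ⟨θ, h⟩ := (rel_iff _ _).1 h
    refine (rel_iff _ _).2 ⟨θ.symm, fun V => ?_⟩
    rw [← h V]
    exact θ.inv_hom_id_app_assoc _ _
  trans {p q r} h h' := by
    obtain ⟨θ, h⟩ := (rel_iff _ _).1 h
    obtain ⟨θ', h'⟩ := (rel_iff _ _).1 h'
    refine (rel_iff _ _).2 ⟨θ ≪≫ θ', fun V => ?_⟩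
    rw [← h V, ← h' V]
    exact Category.assoc _ _ _

/-- The equivalence relation on functors. -/
instance setoid (A B : FinTilde k n) : Setoid (PreHom A B) := ⟨Rel, rel_equivalence A B⟩

/-- The identity functor. -/
def id (A : FinTilde k n) : PreHom A A where
  functor := 𝟭 A
  additive := inferInstance
  linear := inferInstance
  preservesFiniteLimits := inferInstance
  preservesFiniteColimits := inferInstance
  σ := Functor.rightUnitor _

/-- The composite of functors. -/
def comp (p : PreHom A B) (q : PreHom B C) : PreHom A C where
  functor := p.functor ⋙ q.functor
  additive := by
    have := p.additive; have := q.additive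
    infer_instance
  linear := by
    have := p.additive; have := q.additive; have := p.linear; have := q.linear
    infer_instance
  preservesFiniteLimits := by
    have := p.preservesFiniteLimits; have := q.preservesFiniteLimits
    exact comp_preservesFiniteLimits _ _
  preservesFiniteColimits := by
    have := p.preservesFiniteColimits; have := q.preservesFiniteColimits
    exact comp_preservesFiniteColimits _ _
  σ := (Functor.associator _ _ _).symm ≪≫ Functor.isoWhiskerRight p.σ q.functor ≪≫ q.σ

lemma comp_σ (p : PreHom A B) (q : PreHom B C) (V : Vect k n) :
    (p.comp q).σ.hom.app V = q.functor.map (p.σ.hom.app V) ≫ q.σ.hom.app V := by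
  simp [comp]

lemma comp_rel {p p' : PreHom A B} {q q' : PreHom B C} (hp : p.Rel p') (hq : q.Rel q') :
    (p.comp q).Rel (p'.comp q') := by
  obtain ⟨θ, h⟩ := (rel_iff _ _).1 hp
  obtain ⟨θ', h'⟩ := (rel_iff _ _).1 hq
  refine (rel_iff _ _).2 ⟨Functor.isoWhiskerRight θ q.functor ≪≫
    Functor.isoWhiskerLeft p'.functor θ', fun V => ?_⟩
  rw [comp_σ, comp_σ, ← h V, ← h' V]
  have e : ((Functor.isoWhiskerRight θ q.functor ≪≫
    Functor.isoWhiskerLeft p'.functor θ').hom.app (A.incl.obj V)) =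
    q.functor.map (θ.hom.app _) ≫ θ'.hom.app _ := by simp
  refine (congrArg (· ≫ _) e).trans ?_
  simp

end PreHom

/-- Morphisms of `Fin~_n`: isomorphism classes of exact functors preserving the simple objects. -/
def Hom (A B : FinTilde k n) : Type (u + 1) := Quotient (PreHom.setoid A B)

instance : Category.{u + 1} (FinTilde k n) where
  Hom := Hom
  id A := Quotient.mk _ (PreHom.id A)
  comp f g := Quotient.map₂ PreHom.comp (fun _ _ hp _ _ hq => PreHom.comp_rel hp hq) f g
  id_comp f := by
    induction f using Quotient.inductionOn with
    | h p =>
      refine Quotient.sound ((PreHom.rel_iff _ _).2 ⟨Functor.leftUnitor _, fun V => ?_⟩)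
      rw [PreHom.comp_σ]
      simp [PreHom.id, PreHom.comp]
  comp_id f := by
    induction f using Quotient.inductionOn with
    | h p =>
      refine Quotient.sound ((PreHom.rel_iff _ _).2 ⟨Functor.rightUnitor _, fun V => ?_⟩)
      rw [PreHom.comp_σ]
      simp [PreHom.id, PreHom.comp]
  assoc f g h := by
    induction f using Quotient.inductionOn with
    | h p =>
    induction g using Quotient.inductionOn with
    | h q =>
    induction h using Quotient.inductionOn with
    | h r =>
      refine Quotient.sound ((PreHom.rel_iff _ _).2 ⟨Functor.associator _ _ _, fun V => ?_⟩)
      rw [PreHom.comp_σ, PreHom.comp_σ, PreHom.comp_σ, PreHom.comp_σ]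
      simp [PreHom.comp]

/-- The class of an exact functor. -/
def PreHom.toHom {A B : FinTilde k n} (p : PreHom A B) : A ⟶ B := Quotient.mk _ p

lemma PreHom.toHom_comp {A B C : FinTilde k n} (p : PreHom A B) (q : PreHom B C) :
    p.toHom ≫ q.toHom = (p.comp q).toHom := rfl

/-- The canonical morphism `γ : i_{S(B)}^* ∘ Ψ ⟶ i_{S(A)}^*`, adjoint to the composite
`Ψ ⟶ Ψ ∘ i_{S(A)} ∘ i_{S(A)}^* ≅ i_{S(B)} ∘ i_{S(A)}^*` of `Ψ(unit)` and the identification. -/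
def PreHom.γ {A B : FinTilde k n} (p : PreHom A B) : p.functor ⋙ B.reflect ⟶ A.reflect where
  app M := (B.adj.homEquiv _ _).symm
    (p.functor.map (A.adj.unit.app M) ≫ p.σ.hom.app (A.reflect.obj M))
  naturality M N f := by
    have h1 := A.adj.unit.naturality f
    have h2 := p.σ.hom.naturality (A.reflect.map f)
    dsimp at h1 h2
    dsimp
    rw [← Adjunction.homEquiv_naturality_left_symm, ← Adjunction.homEquiv_naturality_right_symm,
      ← Functor.map_comp_assoc, h1, Functor.map_comp_assoc, h2, Category.assoc]

lemma PreHom.γ_counit {A B : FinTilde k n} (p : PreHom A B) (V : Vect k n) :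
    p.γ.app (A.incl.obj V) ≫ A.adj.counit.app V =
      B.reflect.map (p.σ.hom.app V) ≫ B.adj.counit.app V := by
  have h2 := p.σ.hom.naturality (A.adj.counit.app V)
  dsimp at h2
  dsimp [PreHom.γ]
  rw [← Adjunction.homEquiv_naturality_right_symm, Category.assoc, ← h2,
    ← Functor.map_comp_assoc, Adjunction.right_triangle_components, CategoryTheory.Functor.map_id,
    Category.id_comp, Adjunction.homEquiv_counit]

/-- Every exact `k`-linear functor taking `S_i` to `S_i` admits an identification. -/
lemma exists_preHom {A B : FinTilde k n} (Ψ : A ⥤ B) [Ψ.Additive] [Ψ.Linear k]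
    [PreservesFiniteLimits Ψ] [PreservesFiniteColimits Ψ]
    (h : ∀ i, Nonempty (Ψ.obj (A.S i) ≅ B.S i)) : ∃ p : PreHom A B, p.functor = Ψ :=
  ⟨⟨Ψ, inferInstance, inferInstance, inferInstance, inferInstance,
    sumFunctorCompIso A.S B.S Ψ fun i => (h i).some⟩, rfl⟩

section Deformations

variable {Z : Type (u + 1)} [Category.{u} Z] [Abelian Z] [Linear k Z]
  (P : ObjectProperty Z) (F : Fin n → Z)

variable (k) in
/-- The functor `i₀ : (mod_fd k)^n ⥤ Z`, sending the `i`-th simple object to `F i`. -/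
abbrev i₀ : Vect k n ⥤ Z := sumFunctor F

/-- A deformation of the `F_i` over `A`: an exact `k`-linear functor `T` from `A` to the full
subcategory `P`, and a morphism `φ : T ⟶ i₀ ∘ i_{S(A)}^*` which induces an isomorphism
`T ∘ i_{S(A)} ≅ i₀ ∘ i_{S(A)}^* ∘ i_{S(A)}`. -/
structure DefPair (A : FinTilde k n) where
  T : A ⥤ Z
  prop_obj : ∀ M, P (T.obj M)
  additive : T.Additive
  linear : T.Linear k
  preservesFiniteLimits : PreservesFiniteLimits T
  preservesFiniteColimits : PreservesFiniteColimits T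
  φ : T ⟶ A.reflect ⋙ i₀ k F
  isIso_φ : IsIso (Functor.whiskerLeft A.incl φ)

namespace DefPair

variable {P F} {A B C : FinTilde k n}

/-- `(T, φ) ∼ (T', φ')` if there is an isomorphism `γ : T ≅ T'` with `φ' γ = φ`. -/
def Rel (x y : DefPair P F A) : Prop := ∃ γ : x.T ≅ y.T, γ.hom ≫ y.φ = x.φ

lemma rel_equivalence : Equivalence (Rel (P := P) (F := F) (A := A)) where
  refl x := ⟨Iso.refl _, Category.id_comp _⟩
  symm {x y} h := by
    obtain ⟨γ, h⟩ := h
    exact ⟨γ.symm, by simp [← h]⟩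
  trans {x y z} h h' := by
    obtain ⟨γ, h⟩ := h
    obtain ⟨γ', h'⟩ := h'
    exact ⟨γ ≪≫ γ', by simp [← h, ← h']⟩

variable (P F A) in
/-- The equivalence relation on deformations. -/
def setoid : Setoid (DefPair P F A) := ⟨Rel, rel_equivalence⟩

/-- The morphism `T ∘ i_{S(A)} ⟶ i₀` adjoint to `φ`. -/
def flat {T : A ⥤ Z} (φ : T ⟶ A.reflect ⋙ i₀ k F) (V : Vect k n) :
    T.obj (A.incl.obj V) ⟶ (i₀ k F).obj V :=
  φ.app (A.incl.obj V) ≫ (i₀ k F).map (A.adj.counit.app V)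

lemma eq_of_flat {T : A ⥤ Z} (φ : T ⟶ A.reflect ⋙ i₀ k F) (M : A) :
    φ.app M = T.map (A.adj.unit.app M) ≫ flat φ (A.reflect.obj M) := by
  have h := φ.naturality (A.adj.unit.app M)
  dsimp at h
  dsimp [flat]
  rw [reassoc_of% h, ← Functor.map_comp, Adjunction.left_triangle_components, CategoryTheory.Functor.map_id,
    Category.comp_id]

lemma isIso_iff_flat [IsAlgClosed k] {T : A ⥤ Z} (φ : T ⟶ A.reflect ⋙ i₀ k F) :
    IsIso (Functor.whiskerLeft A.incl φ) ↔ ∀ V, IsIso (flat φ V) := by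
  rw [NatTrans.isIso_iff_isIso_app]
  refine forall_congr' fun V => ?_
  dsimp [flat]
  exact (isIso_comp_right_iff _ _).symm

/-- `φ' : T ∘ Ψ ⟶ i₀ ∘ i_{S(B)}^* ∘ Ψ ⟶ i₀ ∘ i_{S(A)}^*`, the composite of `φ Ψ` and `i₀ γ`. -/
def pullbackφ (p : PreHom A B) {T : B ⥤ Z} (φ : T ⟶ B.reflect ⋙ i₀ k F) :
    p.functor ⋙ T ⟶ A.reflect ⋙ i₀ k F :=
  Functor.whiskerLeft p.functor φ ≫ Functor.whiskerRight p.γ (i₀ k F)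

lemma flat_pullback (p : PreHom A B) {T : B ⥤ Z} (φ : T ⟶ B.reflect ⋙ i₀ k F)
    (V : Vect k n) : flat (pullbackφ p φ) V = T.map (p.σ.hom.app V) ≫ flat φ V := by
  have h := φ.naturality (p.σ.hom.app V)
  have h2 := p.γ_counit V
  dsimp at h h2
  dsimp [flat, pullbackφ]
  rw [Category.assoc, ← Functor.map_comp, h2, Functor.map_comp, reassoc_of% h]

/-- The deformation `Ψ^*(T, φ) = (T ∘ Ψ, φ')`. -/
def pullback [IsAlgClosed k] (p : PreHom A B) (x : DefPair P F B) : DefPair P F A where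
  T := p.functor ⋙ x.T
  prop_obj M := x.prop_obj _
  additive := by
    have := p.additive; have := x.additive
    infer_instance
  linear := by
    have := p.additive; have := x.additive; have := p.linear; have := x.linear
    infer_instance
  preservesFiniteLimits := by
    have := p.preservesFiniteLimits; have := x.preservesFiniteLimits
    exact comp_preservesFiniteLimits _ _
  preservesFiniteColimits := by
    have := p.preservesFiniteColimits; have := x.preservesFiniteColimits
    exact comp_preservesFiniteColimits _ _
  φ := pullbackφ p x.φ
  isIso_φ := by
    rw [isIso_iff_flat]
    intro V
    have := (isIso_iff_flat x.φ).1 x.isIso_φ V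
    rw [flat_pullback]
    infer_instance

lemma rel_iff (x y : DefPair P F A) : x.Rel y ↔ ∃ γ : x.T ≅ y.T,
    ∀ V, γ.hom.app (A.incl.obj V) ≫ flat y.φ V = flat x.φ V := by
  refine exists_congr fun γ => ⟨fun h V => ?_, fun h => ?_⟩
  · rw [← h]
    simp [flat]
  · ext M
    have h1 := γ.hom.naturality (A.adj.unit.app M)
    dsimp at h1
    rw [NatTrans.comp_app, eq_of_flat y.φ, eq_of_flat x.φ, ← h, ← Category.assoc,
      ← Category.assoc]
    exact congrArg (· ≫ _) h1.symm

lemma pullback_rel [IsAlgClosed k] {p q : PreHom A B} {x y : DefPair P F B}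
    (hp : p.Rel q) (hx : x.Rel y) : (pullback p x).Rel (pullback q y) := by
  obtain ⟨θ, h⟩ := (PreHom.rel_iff _ _).1 hp
  obtain ⟨γ, h'⟩ := (rel_iff _ _).1 hx
  refine (rel_iff _ _).2 ⟨Functor.isoWhiskerRight θ x.T ≪≫
    Functor.isoWhiskerLeft q.functor γ, fun V => ?_⟩
  refine Eq.trans ?_ (flat_pullback p x.φ V).symm
  refine (congrArg (_ ≫ ·) (flat_pullback q y.φ V)).trans ?_
  rw [← h V, ← h' V]
  simp [pullback]

/-- Rescaling the `F_i` by an automorphism `α` of `i₀`: `(T, φ) ↦ (T, α φ)`. -/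
def rescale (α : i₀ k F ≅ i₀ k F) (x : DefPair P F A) : DefPair P F A where
  T := x.T
  prop_obj := x.prop_obj
  additive := x.additive
  linear := x.linear
  preservesFiniteLimits := x.preservesFiniteLimits
  preservesFiniteColimits := x.preservesFiniteColimits
  φ := x.φ ≫ Functor.whiskerLeft A.reflect α.hom
  isIso_φ := by
    have := x.isIso_φ
    rw [Functor.whiskerLeft_comp]
    infer_instance

lemma rescale_rel (α : i₀ k F ≅ i₀ k F) {x y : DefPair P F A} (h : x.Rel y) :
    (x.rescale α).Rel (y.rescale α) := by
  obtain ⟨γ, h⟩ := h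
  exact ⟨γ, (Category.assoc _ _ _).symm.trans
    (congrArg (· ≫ Functor.whiskerLeft A.reflect α.hom) h)⟩

end DefPair

/-- The categorical noncommutative deformation functor `ncDef_{F_1, …, F_n}`. -/
def ncDef [IsAlgClosed k] : (FinTilde k n)ᵒᵖ ⥤ Type (u + 1) where
  obj A := Quotient (DefPair.setoid P F A.unop)
  map {A B} f := ↾(fun x => Quotient.map₂ (sa := PreHom.setoid B.unop A.unop)
    (sb := DefPair.setoid P F A.unop) (sc := DefPair.setoid P F B.unop) DefPair.pullback
    (fun _ _ hp _ _ hq => DefPair.pullback_rel hp hq) f.unop x)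
  map_id A := by
    ext x
    induction x using Quotient.inductionOn with
    | h x =>
      refine Quotient.sound ((DefPair.rel_iff _ _).2 ⟨Functor.leftUnitor _, fun V => ?_⟩)
      refine Eq.trans ?_ (DefPair.flat_pullback (PreHom.id _) x.φ V).symm
      simp [PreHom.id, DefPair.pullback]
  map_comp f g := by
    ext x
    obtain ⟨f⟩ := f
    obtain ⟨g⟩ := g
    induction f using Quotient.inductionOn with
    | h p =>
    induction g using Quotient.inductionOn with
    | h q =>
    induction x using Quotient.inductionOn with
    | h x =>
      refine Quotient.sound ((DefPair.rel_iff _ _).2 ⟨Functor.associator _ _ _, fun V => ?_⟩)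
      refine Eq.trans ?_ (DefPair.flat_pullback (q.comp p) x.φ V).symm
      refine (congrArg (_ ≫ ·) (DefPair.flat_pullback q (DefPair.pullbackφ p x.φ) V)).trans ?_
      rw [DefPair.flat_pullback, PreHom.comp_σ]
      simp [PreHom.comp, DefPair.pullback]

variable {P F} in
/-- The action of the automorphisms of `i₀` on deformation classes, `[(T, φ)] ↦ [(T, α φ)]`. -/
def rescale [IsAlgClosed k] (α : i₀ k F ≅ i₀ k F) {A : (FinTilde k n)ᵒᵖ}
    (x : (ncDef (k := k) P F).obj A) : (ncDef (k := k) P F).obj A :=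
  Quotient.map (sa := DefPair.setoid P F A.unop) (sb := DefPair.setoid P F A.unop)
    (DefPair.rescale α) (fun _ _ h => DefPair.rescale_rel α h) x

end Deformations

end FinTilde

section Extensions

variable (k : Type u) [Field k] {n : ℕ} {Z : Type (u + 1)} [Category.{u} Z] [Abelian Z]
  [Linear k Z] (P : ObjectProperty Z) (F : Fin n → Z)

/-- `dim Hom(F_i, F_j) = δ_ij`. -/
def IsSimpleCollection : Prop :=
  ∀ i j, Module.rank k (F i ⟶ F j) = if i = j then 1 else 0

/-- `M` has a finite filtration whose subquotients are finite direct sums of objects `F_i`. -/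
inductive IsIteratedExtension : Z → Prop
  | zero {M : Z} : IsZero M → IsIteratedExtension M
  | step {S : ShortComplex Z} : S.ShortExact → IsIteratedExtension S.X₁ →
      (∃ (m : ℕ) (a : Fin m → Fin n), Nonempty (S.X₃ ≅ ⨁ fun j => F (a j))) →
      IsIteratedExtension S.X₂

/-- The objects of `ℱ({F_i})`. -/
def iteratedExtensions : ObjectProperty Z := fun M => P M ∧ IsIteratedExtension F M

variable {P F}

open ZeroObject in
lemma iteratedExtensions_self (hF : ∀ i, P (F i)) (i : Fin n) :
    iteratedExtensions P F (F i) := by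
  refine ⟨hF i, ?_⟩
  have hS : (ShortComplex.mk (0 : (0 : Z) ⟶ F i) (𝟙 (F i)) (by simp)).Splitting :=
    { r := 0, s := 𝟙 _, f_r := by ext, s_g := by simp, id := by simp }
  refine IsIteratedExtension.step hS.shortExact (.zero (isZero_zero Z))
    ⟨1, fun _ => i, ⟨⟨biproduct.lift fun _ => 𝟙 _, biproduct.π (fun _ : Fin 1 => F i) 0, ?_, ?_⟩⟩⟩
  · simp
  · apply biproduct.hom_ext
    intro j
    fin_cases j
    simp

/-- The `F_i`, as objects of `ℱ({F_i})`. -/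
def extSimple (hF : ∀ i, P (F i)) : Fin n → (iteratedExtensions P F).FullSubcategory :=
  fun i => ⟨F i, iteratedExtensions_self hF i⟩

/-- The full subcategory `ℱ({F_i})` as an object of `Fin~_n`, with simple objects
`F_1, …, F_n` in this order. -/
def extCategory (hF : ∀ i, P (F i)) (h : IsFinTilde k (extSimple hF)) : FinTilde k n where
  carrier := (iteratedExtensions P F).FullSubcategory
  S := extSimple hF
  isFinTilde := h

end Extensions

end Dagger

section Sheaves

open AlgebraicGeometry

variable (k : Type u) [Field k] (X : Scheme.{u}) [X.Over (Spec (.of k))]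

/-- The homomorphism `k → 𝒪_X(U)` given by the structure morphism `X ⟶ Spec k`. -/
def scalars (U : X.Opens) : k →+* Γ(X, U) :=
  ((X.presheaf.map (homOfLE le_top : U ⟶ ⊤).op).hom.comp
    ((X ↘ Spec (.of k)).appTop.hom)).comp (Scheme.ΓSpecIso (.of k)).inv.hom

lemma map_scalars {U V : X.Opens} (i : U ⟶ V) (a : k) :
    X.presheaf.map i.op (scalars k X V a) = scalars k X U a := by
  simp only [scalars, RingHom.comp_apply]
  rw [← CommRingCat.comp_apply, ← X.presheaf.map_comp]
  rfl


/-- Multiplication by `a` on an `𝒪_X`-module. -/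
def scalarEnd (M : X.Modules) (a : k) : M ⟶ M :=
  SheafOfModules.Hom.mk (PresheafOfModules.homMk
    { app := fun U => M.smul (scalars k X U.unop a)
      naturality := fun U V i => by
        have h := M.map_comp_smul i.unop (scalars k X U.unop a)
        rw [map_scalars] at h
        exact h.symm }
    (fun U r m => by
      change scalars k X U.unop a • (show Γ(X, U.unop) from r) • (show Γ(M, U.unop) from m) =
        (show Γ(X, U.unop) from r) • scalars k X U.unop a • (show Γ(M, U.unop) from m)
      exact smul_comm _ _ _))

@[simp]
lemma scalarEnd_app_apply (M : X.Modules) (a : k) (U : X.Opens) (m : Γ(M, U)) :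
    (scalarEnd k X M a).app U m = scalars k X U a • m := rfl

lemma modules_hom_ext {M N : X.Modules} {f g : M ⟶ N}
    (h : ∀ (U : X.Opens) (m : Γ(M, U)), f.app U m = g.app U m) : f = g := by
  apply Scheme.Modules.hom_ext
  intro U
  ext m
  exact h U m

/-- The action of `k` on all `𝒪_X`-modules, by central endomorphisms. -/
def scalarCenter : k →+* CatCenter X.Modules where
  toFun a :=
    { app := fun M => scalarEnd k X M a
      naturality := fun M N f => modules_hom_ext X fun U m =>
        (f.app_smul (scalars k X U a) m).symm }
  map_one' := by
    ext M U m
    change scalars k X U 1 • m = m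
    rw [map_one, one_smul]
  map_mul' a b := by
    ext M U m
    change scalars k X U (a * b) • m = scalars k X U a • scalars k X U b • m
    rw [map_mul, mul_smul]
  map_zero' := by
    ext M U m
    change scalars k X U 0 • m = 0
    rw [map_zero, zero_smul]
  map_add' a b := by
    ext M U m
    change scalars k X U (a + b) • m = scalars k X U a • m + scalars k X U b • m
    rw [map_add, add_smul]

/-- For a `k`-scheme `X`, the category of `𝒪_X`-modules is `k`-linear: `(a • f)(m) = a • f(m)`. -/
instance : Linear k X.Modules := Linear.ofRingMorphism (scalarCenter k X)

lemma smul_app_apply {M N : X.Modules} (a : k) (f : M ⟶ N) (U : X.Opens) (m : Γ(M, U)) :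
    (a • f).app U m = scalars k X U a • f.app U m :=
  f.app_smul (scalars k X U a) m

variable {X}

/-- The restriction of a section of `M`. -/
abbrev res (M : X.Modules) {U V : X.Opens} (i : U ≤ V) (s : Γ(M, V)) : Γ(M, U) :=
  M.presheaf.map (homOfLE i).op s

/-- `M` is a coherent `𝒪_X`-module: it is of finite type (locally there are finitely many sections
`s_1, …, s_m` such that any section is locally a combination of them), and for any open `U` and any
`s_1, …, s_m ∈ M(U)` the kernel of `𝒪_U^m ⟶ M|_U` is of finite type. On a locally Noetherian
scheme these are the quasi-coherent modules of finite type. -/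
structure IsCoherent (M : X.Modules) : Prop where
  finiteType : ∀ x : X, ∃ (U : X.Opens), x ∈ U ∧ ∃ (m : ℕ) (s : Fin m → Γ(M, U)),
    ∀ (V : X.Opens) (hVU : V ≤ U) (t : Γ(M, V)), ∀ y ∈ V, ∃ (W : X.Opens) (hWV : W ≤ V), y ∈ W ∧
      ∃ c : Fin m → Γ(X, W), res M hWV t = ∑ i, c i • res M (hWV.trans hVU) (s i)
  relations : ∀ (U : X.Opens) (m : ℕ) (s : Fin m → Γ(M, U)), ∀ x ∈ U,
    ∃ (V : X.Opens) (hVU : V ≤ U), x ∈ V ∧ ∃ (l : ℕ) (r : Fin l → Fin m → Γ(X, V)),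
      (∀ j, ∑ i, r j i • res M hVU (s i) = 0) ∧
      ∀ (W : X.Opens) (hWV : W ≤ V) (t : Fin m → Γ(X, W)),
        ∑ i, t i • res M (hWV.trans hVU) (s i) = 0 → ∀ y ∈ W, ∃ (W' : X.Opens) (hW : W' ≤ W),
          y ∈ W' ∧ ∃ c : Fin l → Γ(X, W'), ∀ i, X.presheaf.map (homOfLE hW).op (t i) =
            ∑ j, c j * X.presheaf.map (homOfLE (hW.trans hWV)).op (r j i)

variable (X) in
/-- The coherent sheaves on `X`, as a property of `𝒪_X`-modules: `Coh(X)` is the corresponding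
full subcategory. A sequence of coherent sheaves is exact if it is exact in `X.Modules`. -/
abbrev isCoherent : ObjectProperty X.Modules := IsCoherent

end Sheaves

end

end NCDef

open AlgebraicGeometry NCDef

/-! The inclusion of ℱ = ℱ({F_i}) into Coh(X) is itself a deformation of the F_i, and it is the
universal one. By the adjunction i_A^* ⊣ i_A, a pair (T, φ) over A is the same as an exact functor T
with an identification T i_A ≅ i₀ (`DefPair.flatIso`, `DefPair.sharp`). Every object of A has a
finite filtration with simple subquotients, and T turns it into a filtration with subquotients F_i,
so T takes values in ℱ (`isSimpleIterated_obj`). As the inclusion is exact and fully faithful, T and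
its identification lift to a morphism A ⟶ ℱ (`exists_pullback_rel`), and isomorphisms between pairs
lift as well (`rel_of_pullback_rel`). Hence the Yoneda transformation attached to the inclusion is
bijective. An isomorphism of underlying functors changes the identification by an automorphism of
i_ℱ, which corresponds to one of i₀; this gives the statement on orbits
(`nonempty_iso_iff_exists_rescale`).

It remains to see that ℱ lies in the category Fin~_n. The simple collection condition gives Schur's
lemma for the F_i, and from it a nonzero map from an iterated extension to some F_i is an
epimorphism with kernel in ℱ (`epi_of_ne_zero`). Induction on the target then shows that ℱ is closed
under kernels and cokernels (`kernel_cokernel`), so ℱ is abelian, its inclusion is exact, and its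
simple objects are the F_i.

Finiteness of Hom and Ext¹ between iterated extensions follows by dévissage, and Ext¹ computed in ℱ
embeds into the ambient Ext¹ (`mapExactFunctor_one_injective`). Since extension classes form small
sets and determine the middle term, ℱ is essentially small (`exists_smallFamily`). All this takes
place among 𝒪_X-modules; extensions of coherent modules are coherent (`IsCoherent.of_shortExact`),
so coherence imposes no further condition on iterated extensions. -/

namespace NCDef

noncomputable section

/-! ### Kernels and cokernels of a composite. -/

section KernelCokernel

variable {C : Type u} [Category.{v} C] [Abelian C] {L M N : C} (f : L ⟶ M) (g : M ⟶ N)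

/-- The morphism `ker (f ≫ g) ⟶ ker g` induced by `f`. -/
abbrev kernelCompMap : kernel (f ≫ g) ⟶ kernel g :=
  kernel.map (f ≫ g) g f (𝟙 _) (by simp)

/-- The inclusion `ker f ⟶ ker (f ≫ g)`. -/
abbrev kernelToKernelComp : kernel f ⟶ kernel (f ≫ g) :=
  kernel.map f (f ≫ g) (𝟙 _) g (by simp)

/-- The morphism `coker f ⟶ coker (f ≫ g)` induced by `g`. -/
abbrev cokernelMapComp : cokernel f ⟶ cokernel (f ≫ g) :=
  cokernel.map f (f ≫ g) (𝟙 _) g (by simp)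

/-- The connecting morphism `ker g ⟶ coker f`. -/
abbrev kernelToCokernel : kernel g ⟶ cokernel f := kernelCokernelCompSequence.δ f g

lemma kernelComp_exact₁ :
    (ShortComplex.mk (kernelToKernelComp f g) (kernelCompMap f g) (by ext; simp)).Exact :=
  (kernelCokernelCompSequence_exact f g).exact 0

lemma kernelCompMap_comp : kernelCompMap f g ≫ kernelToCokernel f g = 0 :=
  (kernelCokernelCompSequence_exact f g).toIsComplex.zero 1

lemma kernelToCokernel_comp : kernelToCokernel f g ≫ cokernelMapComp f g = 0 :=
  (kernelCokernelCompSequence_exact f g).toIsComplex.zero 2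

lemma kernelComp_exact₂ :
    (ShortComplex.mk (kernelCompMap f g) (kernelToCokernel f g) (kernelCompMap_comp f g)).Exact :=
  (kernelCokernelCompSequence_exact f g).exact 1

lemma kernelComp_exact₃ :
    (ShortComplex.mk (kernelToCokernel f g) (cokernelMapComp f g)
      (kernelToCokernel_comp f g)).Exact :=
  (kernelCokernelCompSequence_exact f g).exact 2

lemma kernelComp_exact₄ :
    (ShortComplex.mk (cokernelMapComp f g) (cokernel.map (f ≫ g) g f (𝟙 _) (by simp))
      (by ext; simp)).Exact :=
  (kernelCokernelCompSequence_exact f g).exact 3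

instance : Mono (kernelToKernelComp f g) := by
  have : Mono (kernelToKernelComp f g ≫ kernel.ι (f ≫ g)) := by
    simpa using inferInstanceAs (Mono (kernel.ι f))
  exact mono_of_mono _ (kernel.ι (f ≫ g))

lemma nonempty_kernel_kernelCompMap_iso : Nonempty (kernel (kernelCompMap f g) ≅ kernel f) :=
  ⟨IsLimit.conePointUniqueUpToIso (kernelIsKernel _) (kernelComp_exact₁ f g).fIsKernel⟩

/-- For an epimorphism `f`, the sequence `0 ⟶ ker f ⟶ ker (f ≫ g) ⟶ ker g ⟶ 0` is exact. -/
lemma kernelComp_shortExact [Epi f] :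
    (ShortComplex.mk (kernelToKernelComp f g) (kernelCompMap f g)
      (by ext; simp)).ShortExact := by
  have : Epi (kernelCompMap f g) := (kernelComp_exact₂ f g).epi_f
    ((isZero_cokernel_of_epi f).eq_of_tgt _ _)
  exact .mk' (kernelComp_exact₁ f g) inferInstance this

/-- For an epimorphism `g`, the sequence
`0 ⟶ coker (ker (f ≫ g) ⟶ ker g) ⟶ coker f ⟶ coker (f ≫ g) ⟶ 0` is exact. -/
lemma cokernelComp_shortExact [Epi g] :
    ∃ (i : cokernel (kernelCompMap f g) ⟶ cokernel f) (zero : i ≫ cokernelMapComp f g = 0),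
      (ShortComplex.mk i (cokernelMapComp f g) zero).ShortExact := by
  have h := (kernelComp_exact₂ f g).mono_cokernelDesc
  refine ⟨cokernel.desc _ _ (kernelCompMap_comp f g), ?_, .mk' ?_ h ?_⟩
  · ext
    simpa using kernelToCokernel_comp f g
  -- Replacing ker g by a quotient through which the connecting map factors does not change the
  -- image, so exactness at coker f is inherited.
  · let φ : ShortComplex.mk _ _ (kernelToCokernel_comp f g) ⟶
        ShortComplex.mk (cokernel.desc _ _ (kernelCompMap_comp f g)) (cokernelMapComp f g)
          (by ext; simpa using kernelToCokernel_comp f g) :=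
      { τ₁ := cokernel.π (kernelCompMap f g), τ₂ := 𝟙 _, τ₃ := 𝟙 _ }
    have : Epi φ.τ₁ := inferInstanceAs (Epi (cokernel.π (kernelCompMap f g)))
    have : IsIso φ.τ₂ := inferInstanceAs (IsIso (𝟙 _))
    have : Mono φ.τ₃ := inferInstanceAs (Mono (𝟙 _))
    exact (ShortComplex.exact_iff_of_epi_of_isIso_of_mono φ).1 (kernelComp_exact₃ f g)
  · exact (kernelComp_exact₄ f g).epi_f ((isZero_cokernel_of_epi g).eq_of_tgt _ _)

/-- For monomorphisms `f`, if `f ≫ g` is an epimorphism, then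
`0 ⟶ ker (f ≫ g) ⟶ ker g ⟶ coker f ⟶ 0` is exact. -/
lemma kernelComp_shortExact' [Mono f] [Epi (f ≫ g)] :
    (ShortComplex.mk (kernelCompMap f g) (kernelToCokernel f g)
      (kernelCompMap_comp f g)).ShortExact := by
  refine .mk' (kernelComp_exact₂ f g) ?_ ?_
  · exact (kernelComp_exact₁ f g).mono_g ((isZero_kernel_of_mono f).eq_of_src _ _)
  · exact (kernelComp_exact₃ f g).epi_f ((isZero_cokernel_of_epi (f ≫ g)).eq_of_tgt _ _)

end KernelCokernel

/-! ### Iterated extensions, one F_i at a time. -/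

section SimpleIterated

variable {n : ℕ} {Z : Type u} [Category.{v} Z] [Abelian Z] (F : Fin n → Z)

/-- `M` is obtained from zero by finitely many extensions by the objects `F i`. -/
inductive IsSimpleIterated : Z → Prop
  | zero {M : Z} : IsZero M → IsSimpleIterated M
  | step {M : Z} {i : Fin n} (g : M ⟶ F i) [Epi g] : IsSimpleIterated (kernel g) →
      IsSimpleIterated M

variable {F}

namespace IsSimpleIterated

lemma of_iso {M : Z} (h : IsSimpleIterated F M) : ∀ {N : Z}, (M ≅ N) → IsSimpleIterated F N := by
  induction h with
  | zero h => exact fun e => .zero (h.of_iso e.symm)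
  | step g _ ih => exact fun e => .step (e.inv ≫ g) (ih (kernelIsIsoComp _ _).symm)

/-- Induction on the quotient: composing with its top map to F_i leaves a kernel which is an
extension of a shorter quotient by the same subobject. The quotient is given up to isomorphism so
that S can vary in the induction. -/
lemma of_shortExact {M : Z} (hM : IsSimpleIterated F M) : ∀ {S : ShortComplex Z},
    S.ShortExact → IsSimpleIterated F S.X₁ → (S.X₃ ≅ M) → IsSimpleIterated F S.X₂ := by
  induction hM with
  | zero h =>
    intro S hS h₁ e
    have := hS.isIso_f_iff.2 (h.of_iso e)
    exact h₁.of_iso (asIso S.f)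
  | @step M i g _ _ ih =>
    intro S hS h₁ e
    have := hS.epi_g
    have := hS.mono_f
    refine .step (S.g ≫ e.hom ≫ g) ?_
    refine ih (kernelComp_shortExact S.g (e.hom ≫ g)) (h₁.of_iso ?_) (kernelIsIsoComp _ _)
    exact IsLimit.conePointUniqueUpToIso hS.fIsKernel (limit.isLimit (parallelPair S.g 0))

lemma of_mem (i : Fin n) : IsSimpleIterated F (F i) :=
  .step (𝟙 _) (.zero (isZero_kernel_of_mono _))

lemma extension {S : ShortComplex Z} (hS : S.ShortExact) (h₁ : IsSimpleIterated F S.X₁)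
    (h₃ : IsSimpleIterated F S.X₃) : IsSimpleIterated F S.X₂ :=
  h₃.of_shortExact hS h₁ (Iso.refl _)

lemma biprod {M N : Z} (hM : IsSimpleIterated F M) (hN : IsSimpleIterated F N) :
    IsSimpleIterated F (M ⊞ N) :=
  extension (ShortComplex.Splitting.ofHasBinaryBiproduct M N).shortExact hM hN

/-- A nonzero morphism to `F i` is an epimorphism whose kernel is again an iterated extension. -/
lemma epi_of_ne_zero (hF : ∀ i j (f : F i ⟶ F j), f ≠ 0 → IsIso f) {M : Z}
    (hM : IsSimpleIterated F M) : ∀ {i : Fin n} (f : M ⟶ F i), f ≠ 0 →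
      Epi f ∧ IsSimpleIterated F (kernel f) := by
  induction hM with
  | zero h => exact fun f hf => (hf (h.eq_of_src _ _)).elim
  | @step M j g _ hg ih =>
    intro i f hf
    have hS : (ShortComplex.mk (kernel.ι g) g (kernel.condition g)).Exact :=
      ShortComplex.exact_kernel g
    -- If f vanishes on ker g, it is g followed by a nonzero map F_j ⟶ F_i, an isomorphism by `hF`.
    -- Otherwise induction applies to f restricted to ker g, and ker f is an extension of F_j by the
    -- kernel of that restriction.
    by_cases h : kernel.ι g ≫ f = 0
    · obtain ⟨q, hq⟩ : ∃ q, g ≫ q = f := ⟨hS.desc f h, hS.g_desc f h⟩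
      have := hF _ _ q (by rintro rfl; exact hf (by simp [← hq]))
      subst hq
      exact ⟨inferInstance, hg.of_iso (kernelCompMono g q).symm⟩
    · obtain ⟨h1, h2⟩ := ih (kernel.ι g ≫ f) h
      refine ⟨epi_of_epi (kernel.ι g) f, ?_⟩
      exact (of_mem j).of_shortExact (kernelComp_shortExact' (kernel.ι g) f) h2
        (IsColimit.coconePointUniqueUpToIso (cokernelIsCokernel _) hS.gIsCokernel)

/-- Induction on the target, with top map g : N ⟶ F_i. The composite f ≫ g is zero or an epimorphism
with known kernel, and f induces a map ker (f ≫ g) ⟶ ker g into a shorter target. That map has the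
same kernel as f, and coker f is an extension of coker (f ≫ g) by its cokernel. -/
lemma kernel_cokernel (hF : ∀ i j (f : F i ⟶ F j), f ≠ 0 → IsIso f) {N : Z}
    (hN : IsSimpleIterated F N) : ∀ {M : Z} (f : M ⟶ N), IsSimpleIterated F M →
      IsSimpleIterated F (kernel f) ∧ IsSimpleIterated F (cokernel f) := by
  induction hN with
  | zero h =>
    intro M f hM
    obtain rfl : f = 0 := h.eq_of_tgt _ _
    exact ⟨hM.of_iso kernelZeroIsoSource.symm, .zero (h.of_iso cokernelZeroIsoTarget)⟩
  | @step N i g _ hg ih =>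
    intro M f hM
    have key : IsSimpleIterated F (kernel (f ≫ g)) ∧ IsSimpleIterated F (cokernel (f ≫ g)) := by
      by_cases h : f ≫ g = 0
      · rw [h]
        exact ⟨hM.of_iso kernelZeroIsoSource.symm, (of_mem i).of_iso cokernelZeroIsoTarget.symm⟩
      · obtain ⟨_, h2⟩ := hM.epi_of_ne_zero hF _ h
        exact ⟨h2, .zero (isZero_cokernel_of_epi _)⟩
    obtain ⟨h1, h2⟩ := ih (kernelCompMap f g) key.1
    refine ⟨h1.of_iso (nonempty_kernel_kernelCompMap_iso f g).some, ?_⟩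
    obtain ⟨_, _, hS⟩ := cokernelComp_shortExact f g
    exact extension hS h2 key.2

end IsSimpleIterated

end SimpleIterated

/-! ### Comparison with filtrations by direct sums of the F_i. -/

section

attribute [local instance] Abelian.hasFiniteBiproducts

lemma IsSimpleIterated.biproduct {n : ℕ} {Z : Type u} [Category.{v} Z] [Abelian Z]
    {F : Fin n → Z} {m : ℕ} (G : Fin m → Z) (hG : ∀ j, IsSimpleIterated F (G j)) :
    IsSimpleIterated F (⨁ G) := by
  induction m with
  | zero =>
    refine .zero ((IsZero.iff_id_eq_zero _).2 ?_)
    apply biproduct.hom_ext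
    exact fun j => j.elim0
  | succ m ih =>
    have hS : (ShortComplex.mk (biproduct.lift (Fin.cons 0 fun j => biproduct.π _ j) :
        (⨁ fun j : Fin m => G j.succ) ⟶ ⨁ G) (biproduct.π G 0) (by simp)).Splitting :=
      { r := biproduct.lift fun j => biproduct.π G j.succ
        s := biproduct.ι G 0
        f_r := by
          apply biproduct.hom_ext
          intro j
          simp
        s_g := by simp
        id := by
          apply biproduct.hom_ext
          intro j
          refine Fin.cases ?_ (fun j => ?_) j
          · simp
          · simp [biproduct.ι_π_ne G (Fin.succ_ne_zero j).symm] }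
    exact extension hS.shortExact (ih _ fun j => hG _) (hG 0)

variable {n : ℕ} {Z : Type (u + 1)} [Category.{u} Z] [Abelian Z] {F : Fin n → Z}

/-- A direct sum of F_i's is itself an iterated extension, so a filtration by direct sums can be
refined; all later inductions use the refined form. -/
lemma isIteratedExtension_iff {M : Z} : IsIteratedExtension F M ↔ IsSimpleIterated F M := by
  refine ⟨fun h => ?_, fun h => ?_⟩
  · induction h with
    | zero h => exact .zero h
    | step hS _ h ih =>
      obtain ⟨m, a, ⟨e⟩⟩ := h
      exact (IsSimpleIterated.biproduct _ fun j => .of_mem (a j)).of_shortExact hS ih e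
  · induction h with
    | zero h => exact .zero h
    | @step M i g _ _ ih =>
      refine .step (S := ShortComplex.mk (kernel.ι g) g (kernel.condition g))
        (.mk' (ShortComplex.exact_kernel g) inferInstance inferInstance) ih
        ⟨1, fun _ => i, ⟨⟨biproduct.lift fun _ => 𝟙 _, biproduct.π (fun _ : Fin 1 => F i) 0,
          by simp, ?_⟩⟩⟩
      apply biproduct.hom_ext
      intro j
      fin_cases j
      simp

end

/-! ### Ext¹ and extensions: injectivity, middle terms, dévissage. -/

section ExtOne

open Abelian Pretriangulated DerivedCategory

section

universe w' v' u'

variable {C : Type u} [Category.{v} C] [Abelian C] [HasExt.{w} C]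

/-- Every class in `Ext¹(X, Y)` is killed by a monomorphism out of `Y`. -/
lemma exists_mono_comp_mk₀_eq_zero {X Y : C} (x : Ext.{w} X Y 1) :
    ∃ (E : C) (j : Y ⟶ E), Mono j ∧ x.comp (Ext.mk₀ j) (add_zero 1) = 0 := by
  let := HasDerivedCategory.standard C
  -- Realise the class: complete X ⟶ Y[1] to a triangle Y ⟶ E' ⟶ X ⟶ Y[1]. Its middle term lies in
  -- degree 0 for the t-structure, hence is an object E of C.
  obtain ⟨E', f, g, hT⟩ := distinguished_cocone_triangle₂ (C := DerivedCategory C)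
    (Z := (singleFunctor C 0).obj X) (X := (singleFunctor C 0).obj Y) x.hom
  have hle : E'.IsLE 0 := TStructure.t.isLE₂ _ hT 0
    (inferInstanceAs (((singleFunctor C 0).obj Y).IsLE 0))
    (inferInstanceAs (((singleFunctor C 0).obj X).IsLE 0))
  have hge : E'.IsGE 0 := TStructure.t.isGE₂ _ hT 0
    (inferInstanceAs (((singleFunctor C 0).obj Y).IsGE 0))
    (inferInstanceAs (((singleFunctor C 0).obj X).IsGE 0))
  obtain ⟨E, ⟨e⟩⟩ := exists_iso_singleFunctor_obj_of_isGE_of_isLE E' 0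
  obtain ⟨j, hj⟩ := (singleFunctor C 0).map_surjective (f ≫ e.hom)
  refine ⟨E, j, Preadditive.mono_of_cancel_zero _ fun {A} a ha => ?_, ?_⟩
  · have h1 : (singleFunctor C 0).map a ≫ f = 0 := by
      rw [← cancel_mono e.hom, Category.assoc, ← hj, ← Functor.map_comp, ha, Functor.map_zero,
        zero_comp]
    -- A map killed by j factors through X[-1], which lives in degree 1, and there are no nonzero
    -- maps to it from degree 0.
    obtain ⟨b, hb⟩ := Triangle.coyoneda_exact₂ _ (inv_rot_of_distTriang _ hT)
      ((singleFunctor C 0).map a) h1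
    have h2 : ((shiftFunctor (DerivedCategory C) (-1 : ℤ)).obj
        ((singleFunctor C 0).obj X)).IsGE 1 := TStructure.t.isGE_shift _ 0 (-1) 1
    have h3 : b = 0 := TStructure.t.zero_of_isLE_of_isGE b 0 1 (by lia) inferInstance h2
    rw [h3, zero_comp] at hb
    exact (singleFunctor C 0).map_injective
      (hb.trans ((singleFunctor C 0).map_zero A Y).symm)
  · ext
    have h : x.hom ≫ (shiftFunctor (DerivedCategory C) (1 : ℤ)).map f = 0 :=
      comp_distTriang_mor_zero₃₁ _ hT
    rw [Ext.comp_hom, Ext.mk₀_hom, ShiftedHom.comp_mk₀, Ext.zero_hom, hj, Functor.map_comp]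
    exact (Category.assoc _ _ _).symm.trans ((congrArg (· ≫ _) h).trans zero_comp)

/-- Exact fully faithful functors induce injections on `Ext¹`. -/
lemma mapExactFunctor_one_injective {D : Type u'} [Category.{v'} D] [Abelian D] [HasExt.{w'} D]
    (G : C ⥤ D) [G.Additive] [PreservesFiniteLimits G] [PreservesFiniteColimits G] [G.Full]
    [G.Faithful] (X Y : C) :
    Function.Injective (G.mapExtAddHom X Y 1 : Ext.{w} X Y 1 →+ Ext.{w'} (G.obj X) (G.obj Y) 1) := by
  rw [injective_iff_map_eq_zero]
  intro x hx
  -- The class x is the pullback of the extension Y ⟶ E ⟶ coker j along some a : X ⟶ coker j, so x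
  -- vanishes as soon as a lifts to E.
  obtain ⟨E, j, _, hj⟩ := exists_mono_comp_mk₀_eq_zero x
  have hS : (ShortComplex.mk j (cokernel.π j) (cokernel.condition j)).ShortExact :=
    .mk' (ShortComplex.exact_cokernel j) inferInstance inferInstance
  obtain ⟨y, hy⟩ := Ext.covariant_sequence_exact₁ X hS x hj (n₀ := 0) rfl
  obtain ⟨a, rfl⟩ := (Ext.mk₀_bijective _ _).2 y
  subst hy
  rw [Functor.mapExtAddHom_apply, Ext.mapExactFunctor_comp, Ext.mapExactFunctor_mk₀,
    Ext.mapExactFunctor_extClass] at hx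
  -- Since G(x) = 0, the map G(a) lifts to G(E); by fullness and faithfulness this lift comes from a
  -- lift of a.
  obtain ⟨z, hz⟩ := Ext.covariant_sequence_exact₃ (G.obj X) (hS.map_of_exact G) _ _ hx
  obtain ⟨b, rfl⟩ := (Ext.mk₀_bijective _ _).2 z
  obtain ⟨b, rfl⟩ := G.map_surjective b
  have hb : b ≫ cokernel.π j = a := G.map_injective ((G.map_comp _ _).trans
    ((Ext.mk₀_bijective _ _).1 ((Ext.mk₀_comp_mk₀ (G.map b) (G.map (cokernel.π j))).symm.trans hz)))
  rw [← hb, ← Ext.mk₀_comp_mk₀_assoc]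
  exact (congrArg (fun t => (Ext.mk₀ b).comp t (zero_add 1)) hS.comp_extClass).trans
    (Ext.comp_zero _ _ _ _ _)

/-- Two extensions with the same class have isomorphic middle terms. -/
lemma nonempty_iso_of_extClass_eq {X Y E E' : C} {f : Y ⟶ E} {g : E ⟶ X} {zero : f ≫ g = 0}
    {f' : Y ⟶ E'} {g' : E' ⟶ X} {zero' : f' ≫ g' = 0}
    (h : (ShortComplex.mk f g zero).ShortExact) (h' : (ShortComplex.mk f' g' zero').ShortExact)
    (heq : h.extClass = h'.extClass) : Nonempty (E ≅ E') := by
  have h0 : h.extClass.comp (Ext.mk₀ f') (add_zero 1) = 0 := by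
    rw [heq]
    exact h'.extClass_comp
  -- As f' kills the common class, it extends along f to φ : E ⟶ E', which induces some endomorphism
  -- e of X, not necessarily the identity.
  obtain ⟨y, hy⟩ := Ext.contravariant_sequence_exact₁ h E' (Ext.mk₀ f') (add_zero 1) h0
  obtain ⟨φ, rfl⟩ := (Ext.mk₀_bijective _ _).2 y
  have hφ : f ≫ φ = f' := (Ext.mk₀_bijective _ _).1 (by rw [← Ext.mk₀_comp_mk₀]; exact hy)
  have := h.epi_g
  obtain ⟨e, he⟩ : ∃ e : X ⟶ X, g ≫ e = φ ≫ g' :=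
    ⟨h.exact.desc (φ ≫ g') (by simp [reassoc_of% hφ, zero']), h.exact.g_desc _ _⟩
  have hn := ShortComplex.ShortExact.extClass_naturality h h'
    { τ₁ := 𝟙 Y, τ₂ := φ, τ₃ := e, comm₁₂ := by simp [hφ], comm₂₃ := he.symm }
  -- By naturality e fixes the class, so e - 1 lifts to d : X ⟶ E'. Subtracting g ≫ d from φ makes
  -- the induced map on X the identity, and the five lemma applies.
  have h1 : (Ext.mk₀ (e - 𝟙 X)).comp h'.extClass (zero_add 1) = 0 := by
    rw [sub_eq_add_neg, Ext.mk₀_add, Ext.mk₀_neg, Ext.add_comp, Ext.neg_comp, ← hn]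
    simp [heq]
  obtain ⟨z, hz⟩ := Ext.covariant_sequence_exact₃ X h' _ _ h1
  obtain ⟨d, rfl⟩ := (Ext.mk₀_bijective _ _).2 z
  have hd : d ≫ g' = e - 𝟙 X := (Ext.mk₀_bijective _ _).1 (by rw [← Ext.mk₀_comp_mk₀]; exact hz)
  let ψ : ShortComplex.mk f g zero ⟶ ShortComplex.mk f' g' zero' :=
    { τ₁ := 𝟙 Y
      τ₂ := φ - g ≫ d
      τ₃ := 𝟙 X
      comm₁₂ := by simp [Preadditive.comp_sub, hφ, reassoc_of% zero]
      comm₂₃ := by simp [Preadditive.sub_comp, hd, ← he] }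
  have : IsIso ψ.τ₁ := inferInstanceAs (IsIso (𝟙 _))
  have : IsIso ψ.τ₃ := inferInstanceAs (IsIso (𝟙 _))
  have : IsIso ψ.τ₂ := ShortComplex.isIso₂_of_shortExact_of_isIso₁₃ ψ h h'
  exact ⟨asIso ψ.τ₂⟩

end

section Devissage

universe t

variable (k : Type t) [Field k] {n : ℕ} {Z : Type u} [Category.{v} Z] [Abelian Z] [Linear k Z]
  [HasExt.{w} Z] {F : Fin n → Z}

lemma finite_of_exact {U V W : Type*} [AddCommGroup U] [AddCommGroup V] [AddCommGroup W]
    [Module k U] [Module k V] [Module k W] [Module.Finite k U] [Module.Finite k W]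
    (f : U →ₗ[k] V) (g : V →ₗ[k] W) (h : ∀ x, g x = 0 → ∃ y, f y = x) : Module.Finite k V := by
  have : Module.Finite k (LinearMap.ker g) :=
    -- The hypothesis does not say that g ∘ f vanishes, so f is first restricted to the vectors that
    -- it sends into ker g.
    Module.Finite.of_surjective ((f.domRestrict (LinearMap.ker (g ∘ₗ f))).codRestrict
      (LinearMap.ker g) fun x => x.2) fun x => by
        obtain ⟨y, hy⟩ := h x.1 x.2
        exact ⟨⟨y, by simp [hy]⟩, Subtype.ext hy⟩
  have : Module.Finite k (V ⧸ LinearMap.ker g) := Module.Finite.equiv g.quotKerEquivRange.symm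
  exact Module.Finite.of_submodule_quotient (LinearMap.ker g)

lemma finite_of_isZero_ext {M N : Z} (h : IsZero M ∨ IsZero N) (d : ℕ) :
    Module.Finite k (Ext.{w} M N d) := by
  have : Subsingleton (Ext.{w} M N d) := by
    refine ⟨fun x y => ?_⟩
    obtain h | h := h
    · rw [← Ext.mk₀_id_comp x, ← Ext.mk₀_id_comp y, h.eq_of_src (𝟙 M) 0]
      simp
    · rw [← Ext.comp_mk₀_id x, ← Ext.comp_mk₀_id y, h.eq_of_src (𝟙 N) 0]
      simp
  infer_instance

/-- The long exact sequence places Ext^d(M, N) between Ext^d(M, ker g) and Ext^d(M, F_j); exactness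
in the middle suffices, so each degree d can be treated on its own. -/
lemma IsSimpleIterated.finite_ext_right (d : ℕ) {M : Z}
    (h : ∀ j, Module.Finite k (Ext.{w} M (F j) d)) {N : Z} (hN : IsSimpleIterated F N) :
    Module.Finite k (Ext.{w} M N d) := by
  induction hN with
  | zero hz => exact finite_of_isZero_ext k (.inr hz) d
  | @step N j g _ _ ih =>
    have hS : (ShortComplex.mk (kernel.ι g) g (kernel.condition g)).ShortExact :=
      .mk' (ShortComplex.exact_kernel g) inferInstance inferInstance
    have := h j
    exact finite_of_exact k ((Ext.mk₀ (kernel.ι g)).postcompOfLinear k M (add_zero d))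
      ((Ext.mk₀ g).postcompOfLinear k M (add_zero d))
      fun x hx => Ext.covariant_sequence_exact₂ M hS x hx

/-- Finiteness of `Ext^d` between the `F i` implies finiteness between iterated extensions. -/
lemma IsSimpleIterated.finite_ext (d : ℕ) (h : ∀ i j, Module.Finite k (Ext.{w} (F i) (F j) d))
    {M N : Z} (hM : IsSimpleIterated F M) (hN : IsSimpleIterated F N) :
    Module.Finite k (Ext.{w} M N d) := by
  induction hM with
  | zero hz => exact finite_of_isZero_ext k (.inl hz) d
  | @step M i g _ _ ih =>
    have hS : (ShortComplex.mk (kernel.ι g) g (kernel.condition g)).ShortExact :=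
      .mk' (ShortComplex.exact_kernel g) inferInstance inferInstance
    have := hN.finite_ext_right k d (h i)
    exact finite_of_exact k ((Ext.mk₀ g).precompOfLinear k N (zero_add d))
      ((Ext.mk₀ (kernel.ι g)).precompOfLinear k N (zero_add d))
      fun x hx => Ext.contravariant_sequence_exact₂ hS N x hx

end Devissage

end ExtOne

/-! ### Finiteness of Hom and Ext¹. -/

section Generalities

universe v' u'

variable (k : Type w) [Field k] {C : Type u} [Category.{v} C] [Abelian C] [Linear k C]

/-- Applied to the inclusion of ℱ, whose own Ext¹ is a priori different from the ambient one but
embeds into it. -/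
lemma finiteExtOne_of_fullyFaithful {D : Type u'} [Category.{v'} D] [Abelian D] [Linear k D]
    (G : C ⥤ D) [G.Additive] [G.Linear k] [PreservesFiniteLimits G] [PreservesFiniteColimits G]
    [G.Full] [G.Faithful] {M N : C} (h : FiniteExtOne k (G.obj M) (G.obj N)) :
    FiniteExtOne k M N := by
  let := HasExt.standard C
  let := HasExt.standard D
  have : Module.Finite k (Abelian.Ext.{max u' v'} (G.obj M) (G.obj N) 1) := h
  exact Module.Finite.of_injective
    (G.mapExtLinearMap k M N 1 : Abelian.Ext.{max u v} M N 1 →ₗ[k] _)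
    (mapExactFunctor_one_injective G M N)

variable {k} in
-- The case d = 0 of the dévissage, since Ext⁰ is Hom.
lemma IsSimpleIterated.finite_hom {n : ℕ} {F : Fin n → C}
    (h : ∀ i j, Module.Finite k (F i ⟶ F j)) {M N : C}
    (hM : IsSimpleIterated F M) (hN : IsSimpleIterated F N) : Module.Finite k (M ⟶ N) := by
  let := HasExt.standard C
  have h0 (i j) : Module.Finite k (Abelian.Ext.{max u v} (F i) (F j) 0) :=
    Module.Finite.equiv (Abelian.Ext.linearEquiv₀ (R := k)).symm
  have := hM.finite_ext k 0 h0 hN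
  exact Module.Finite.equiv (Abelian.Ext.linearEquiv₀ (R := k) (X := M) (Y := N))

variable {k} in
lemma IsSimpleIterated.finiteExtOne {n : ℕ} {F : Fin n → C}
    (h : ∀ i j, FiniteExtOne k (F i) (F j)) {M N : C}
    (hM : IsSimpleIterated F M) (hN : IsSimpleIterated F N) : FiniteExtOne k M N := by
  let := HasExt.standard C
  exact hM.finite_ext k 1 h hN

end Generalities

/-! ### Schur's lemma for a simple collection. -/

section SimpleCollection

variable {k : Type u} [Field k] {n : ℕ} {Z : Type (u + 1)} [Category.{u} Z] [Abelian Z]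
  [Linear k Z] {F : Fin n → Z}

namespace IsSimpleCollection

variable (h : IsSimpleCollection k F)

include h

lemma eq_zero {i j : Fin n} (hij : i ≠ j) (f : F i ⟶ F j) : f = 0 := by
  have := h i j
  rw [if_neg hij, rank_zero_iff_forall_zero] at this
  exact this f

lemma id_ne_zero (i : Fin n) : 𝟙 (F i) ≠ 0 := by
  intro h0
  have := h i i
  rw [if_pos rfl] at this
  have h1 : Module.rank k (F i ⟶ F i) = 0 :=
    rank_zero_iff_forall_zero.2 fun f => by rw [← Category.id_comp f, h0, zero_comp]
  rw [h1] at this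
  exact zero_ne_one this

lemma exists_smul_id {i : Fin n} (f : F i ⟶ F i) : ∃ c : k, c • 𝟙 (F i) = f := by
  have h1 : Module.finrank k (F i ⟶ F i) = 1 :=
    Module.finrank_eq_of_rank_eq (by simpa using h i i)
  exact (finrank_eq_one_iff_of_nonzero' _ (h.id_ne_zero i)).1 h1 f

/-- Maps between different F_i vanish and endomorphisms are scalars. The closure of ℱ under kernels
and cokernels uses the simple collection only through this property. -/
lemma isIso_of_ne_zero (i j : Fin n) (f : F i ⟶ F j) (hf : f ≠ 0) : IsIso f := by
  by_cases hij : i = j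
  · subst hij
    obtain ⟨c, rfl⟩ := h.exists_smul_id f
    have hc : c ≠ 0 := by
      rintro rfl
      exact hf (zero_smul _ _)
    exact ⟨c⁻¹ • 𝟙 _, by simp [smul_smul, hc], by simp [smul_smul, hc]⟩
  · exact (hf (h.eq_zero hij f)).elim

lemma finite_hom (i j : Fin n) : Module.Finite k (F i ⟶ F j) := by
  rw [← Module.rank_lt_aleph0_iff, h i j]
  split_ifs
  · exact Cardinal.one_lt_aleph0
  · exact Cardinal.aleph0_pos

lemma eq_of_iso {i j : Fin n} (e : F i ≅ F j) : i = j := by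
  by_contra hij
  exact h.id_ne_zero i (by rw [← e.hom_inv_id, h.eq_zero hij e.hom, zero_comp])

end IsSimpleCollection

end SimpleCollection

/-! ### Essential smallness of the category of iterated extensions. -/

section Small

variable {k : Type u} [Field k] {n : ℕ} {Z : Type (u + 1)} [Category.{u} Z] [Abelian Z]
  [Linear k Z] {F : Fin n → Z}

lemma small_of_finite (V : Type w) [AddCommGroup V] [Module k V] [Module.Finite k V] :
    Small.{u} V :=
  small_of_injective (Module.finBasis k V).equivFun.injective

variable (F) in
/-- A family of iterated extensions, indexed by a small type. -/
structure SmallFamily where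
  index : Type u
  obj : index → Z
  prop : ∀ a, IsSimpleIterated F (obj a)

open Abelian in
-- Ext¹(F_i, R_a) is finite dimensional over the small field k, hence small, and a class determines
-- the middle term up to isomorphism.
lemma SmallFamily.exists_extension (hExt : ∀ i j, FiniteExtOne k (F i) (F j)) (R : SmallFamily F) :
    ∃ R' : SmallFamily F, ∀ {M : Z} {i : Fin n} (g : M ⟶ F i) [Epi g] (a : R.index),
      Nonempty (kernel g ≅ R.obj a) → ∃ b, Nonempty (M ≅ R'.obj b) := by
  let := HasExt.standard Z
  have hsmall (i a) : Small.{u} (Ext.{u + 1} (F i) (R.obj a) 1) := by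
    have : Module.Finite k (Ext.{u + 1} (F i) (R.obj a) 1) :=
      (IsSimpleIterated.of_mem i).finiteExtOne hExt (R.prop a)
    exact small_of_finite (k := k) _
  let ι := Σ (a : R.index) (i : Fin n), Shrink.{u} (Ext.{u + 1} (F i) (R.obj a) 1)
  let rel (b : ι) (M : Z) : Prop := ∃ (f : R.obj b.1 ⟶ M) (g : M ⟶ F b.2.1) (w : f ≫ g = 0)
    (hS : (ShortComplex.mk f g w).ShortExact), hS.extClass = (equivShrink _).symm b.2.2
  classical
  -- Keeping only the classes realised by some extension avoids having to construct a middle term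
  -- for every class.
  refine ⟨⟨{b : ι // ∃ M, rel b M}, fun b => b.2.choose, fun b => ?_⟩, fun {M i} g _ a he => ?_⟩
  · obtain ⟨f, g, zero, hS, _⟩ := b.2.choose_spec
    exact IsSimpleIterated.extension hS (R.prop _) (.of_mem _)
  · obtain ⟨e⟩ := he
    have h0 : (ShortComplex.mk (kernel.ι g) g (kernel.condition g)).ShortExact :=
      .mk' (ShortComplex.exact_kernel g) inferInstance inferInstance
    have hS : (ShortComplex.mk (e.inv ≫ kernel.ι g) g (by simp)).ShortExact :=
      ShortComplex.shortExact_of_iso (S₁ := ShortComplex.mk (kernel.ι g) g (kernel.condition g))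
        (ShortComplex.isoMk e (Iso.refl _) (Iso.refl _) (by simp) (by simp)) h0
    have hb : rel ⟨a, i, equivShrink _ hS.extClass⟩ M := ⟨_, _, _, hS, by simp⟩
    refine ⟨⟨_, M, hb⟩, ?_⟩
    obtain ⟨f, g', zero, hS', h'⟩ := (⟨M, hb⟩ : ∃ M, rel _ M).choose_spec
    exact nonempty_iso_of_extClass_eq hS hS' (by rw [h']; simp)

open ZeroObject in
-- Starting from the zero object, stage m contains the objects built in m extension steps; the union
-- over the natural numbers is still small.
lemma exists_smallFamily (hExt : ∀ i j, FiniteExtOne k (F i) (F j)) :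
    ∃ R : SmallFamily F, ∀ M, IsSimpleIterated F M → ∃ a, Nonempty (M ≅ R.obj a) := by
  choose next hnext using SmallFamily.exists_extension hExt
  let R : ℕ → SmallFamily F := fun m =>
    Nat.rec ⟨PUnit, fun _ => 0, fun _ => .zero (isZero_zero Z)⟩ (fun _ R => next R) m
  refine ⟨⟨Σ m, (R m).index, fun a => (R a.1).obj a.2, fun a => (R a.1).prop a.2⟩,
    fun M hM => ?_⟩
  suffices h : ∃ m a, Nonempty (M ≅ (R m).obj a) by
    obtain ⟨m, a, h⟩ := h
    exact ⟨⟨m, a⟩, h⟩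
  induction hM with
  | zero h => exact ⟨0, ⟨⟩, ⟨h.iso (isZero_zero Z)⟩⟩
  | step g _ ih =>
    obtain ⟨m, a, h⟩ := ih
    exact ⟨m + 1, hnext (R m) g a h⟩

lemma essentiallySmall_fullSubcategory (hExt : ∀ i j, FiniteExtOne k (F i) (F j))
    (E : ObjectProperty Z) (hE : ∀ M, E M ↔ IsSimpleIterated F M) :
    EssentiallySmall.{u} E.FullSubcategory := by
  obtain ⟨R, hR⟩ := exists_smallFamily hExt
  refine (essentiallySmall_iff _).2 ⟨?_, inferInstance⟩
  refine small_of_surjective (f := fun a : R.index =>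
    toSkeleton (⟨R.obj a, (hE _).2 (R.prop a)⟩ : E.FullSubcategory)) fun x => ?_
  obtain ⟨M, rfl⟩ := Quotient.exists_rep x
  obtain ⟨a, ⟨e⟩⟩ := hR M.obj ((hE _).1 M.property)
  exact ⟨a, Quotient.sound ⟨E.isoMk e.symm⟩⟩

end Small

/-! ### The category ℱ({F_i}) is an object of Fin~_n. -/

section Subcategory

variable {k : Type u} [Field k] {n : ℕ} {Z : Type (u + 1)} [Category.{u} Z] [Abelian Z]
  [Linear k Z] {F : Fin n → Z} {E : ObjectProperty Z}

section

variable (hE : ∀ M, E M ↔ IsSimpleIterated F M)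

include hE

lemma containsZero_of_iff : E.ContainsZero :=
  ⟨⟨_, isZero_zero Z, (hE _).2 (.zero (isZero_zero Z))⟩⟩

lemma isClosedUnderFiniteProducts_of_iff : E.IsClosedUnderFiniteProducts := by
  have := containsZero_of_iff hE
  have : E.IsClosedUnderIsomorphisms := ⟨fun e h => (hE _).2 (((hE _).1 h).of_iso e)⟩
  have : E.IsClosedUnderBinaryProducts := by
    refine ⟨?_⟩
    rintro X ⟨p⟩
    have e : X ≅ p.diag.obj ⟨.left⟩ ⊞ p.diag.obj ⟨.right⟩ :=
      (IsLimit.conePointsIsoOfNatIso p.isLimit (BinaryBiproduct.isLimit _ _)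
        (diagramIsoPair p.diag))
    exact (hE _).2 ((IsSimpleIterated.biprod ((hE _).1 (p.prop_diag_obj _))
      ((hE _).1 (p.prop_diag_obj _))).of_iso e.symm)
  exact .mk'

variable (hF : ∀ i j (f : F i ⟶ F j), f ≠ 0 → IsIso f)

include hF

lemma isClosedUnderKernels_of_iff : E.IsClosedUnderKernels := by
  refine ⟨?_⟩
  rintro _ ⟨f, c, hc, h1, h2⟩
  exact (hE _).2 ((((hE _).1 h2).kernel_cokernel hF f ((hE _).1 h1)).1.of_iso
    (IsLimit.conePointUniqueUpToIso (limit.isLimit (parallelPair f 0)) hc))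

lemma isClosedUnderCokernels_of_iff : E.IsClosedUnderCokernels := by
  refine ⟨?_⟩
  rintro _ ⟨f, c, hc, h1, h2⟩
  exact (hE _).2 ((((hE _).1 h2).kernel_cokernel hF f ((hE _).1 h1)).2.of_iso
    (IsColimit.coconePointUniqueUpToIso (colimit.isColimit (parallelPair f 0)) hc))

lemma isAbelianCat_fullSubcategory : IsAbelianCat E.FullSubcategory := by
  have := containsZero_of_iff hE
  have := isClosedUnderFiniteProducts_of_iff hE
  have := isClosedUnderKernels_of_iff hE hF
  have := isClosedUnderCokernels_of_iff hE hF
  constructor <;> infer_instance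

lemma preservesFiniteLimits_ι : PreservesFiniteLimits E.ι := by
  have := isClosedUnderKernels_of_iff hE hF
  let := (isAbelianCat_fullSubcategory hE hF).abelian
  have := fun {X Y : E.FullSubcategory} (f : X ⟶ Y) => E.preservesKernels_ι f
  exact Functor.preservesFiniteLimits_of_preservesKernels E.ι

lemma preservesFiniteColimits_ι : PreservesFiniteColimits E.ι := by
  have := isClosedUnderCokernels_of_iff hE hF
  let := (isAbelianCat_fullSubcategory hE hF).abelian
  have := fun {X Y : E.FullSubcategory} (f : X ⟶ Y) => E.preservesCokernels_ι f
  exact Functor.preservesFiniteColimits_of_preservesCokernels E.ι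

/-- A nonzero monomorphism into F_i from an object of E is an epimorphism in Z by `epi_of_ne_zero`,
and a monomorphism in Z because the inclusion is left exact. F_i need not be simple in Z. -/
lemma simple_mk (h1 : ∀ i, 𝟙 (F i) ≠ 0) (i : Fin n) (hi : E (F i)) :
    Simple (⟨F i, hi⟩ : E.FullSubcategory) where
  mono_isIso_iff_nonzero {M} f _ := by
    have := preservesFiniteLimits_ι hE hF
    refine ⟨fun _ h0 => h1 i ?_, fun hf => ?_⟩
    · have h2 : 𝟙 (⟨F i, hi⟩ : E.FullSubcategory) = 0 := by
        exact (IsIso.inv_hom_id f).symm.trans ((congrArg _ h0).trans comp_zero)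
      exact congrArg (fun t => t.hom) h2
    · have hf' : f.hom ≠ 0 := fun h => hf (ObjectProperty.hom_ext _ h)
      obtain ⟨_, _⟩ := ((hE _).1 M.property).epi_of_ne_zero hF (i := i) f.hom hf'
      have : Mono f.hom := inferInstanceAs (Mono (E.ι.map f))
      have : IsIso (E.ι.map f) := isIso_of_mono_of_epi f.hom
      exact isIso_of_reflects_iso f E.ι

lemma hasFiniteLength_mk (h1 : ∀ i, 𝟙 (F i) ≠ 0) {M : Z} (hM : IsSimpleIterated F M) :
    ∀ hM' : E M, letI := (isAbelianCat_fullSubcategory hE hF).abelian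
      HasFiniteLength (⟨M, hM'⟩ : E.FullSubcategory) := by
  let := (isAbelianCat_fullSubcategory hE hF).abelian
  have := preservesFiniteLimits_ι hE hF
  have := preservesFiniteColimits_ι hE hF
  induction hM with
  | zero h =>
    refine fun hM' => .zero ((IsZero.iff_id_eq_zero _).2 ?_)
    exact ObjectProperty.hom_ext _ (h.eq_of_src _ _)
  | @step M i g _ hg ih =>
    intro hM'
    have hi : E (F i) := (hE _).2 (.of_mem i)
    let S : ShortComplex E.FullSubcategory :=
      ShortComplex.mk (X₁ := ⟨kernel g, (hE _).2 hg⟩) (X₂ := ⟨M, hM'⟩) (X₃ := ⟨F i, hi⟩)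
        (E.homMk (kernel.ι g)) (E.homMk g) (ObjectProperty.hom_ext _ (kernel.condition g))
    have hS : (S.map E.ι).Exact := ShortComplex.exact_kernel g
    have hf : Mono S.f := E.ι.mono_of_mono_map (inferInstanceAs (Mono (kernel.ι g)))
    have hg' : Epi S.g := E.ι.epi_of_epi_map (inferInstanceAs (Epi g))
    have hS' : S.ShortExact := .mk' ((S.exact_map_iff_of_faithful E.ι).1 hS) hf hg'
    exact .step hS' (ih ((hE _).2 hg)) (simple_mk hE hF h1 i hi)

/-- The last extension step of a nonzero M is a nonzero map to some F_i, and a nonzero map between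
simple objects is invertible. -/
lemma exists_iso_of_simple (h1 : ∀ i, 𝟙 (F i) ≠ 0) (M : E.FullSubcategory) (hM : Simple M) :
    ∃ (i : Fin n) (hi : E (F i)), Nonempty (M ≅ ⟨F i, hi⟩) := by
  let := (isAbelianCat_fullSubcategory hE hF).abelian
  obtain ⟨M, hM'⟩ := M
  cases (hE _).1 hM' with
  | zero h =>
    exact (id_nonzero (⟨M, hM'⟩ : E.FullSubcategory)
      (ObjectProperty.hom_ext _ (h.eq_of_src _ _))).elim
  | @step _ i g _ _ =>
    have hi : E (F i) := (hE _).2 (.of_mem i)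
    have := simple_mk hE hF h1 i hi
    have h0 : (E.homMk g : (⟨M, hM'⟩ : E.FullSubcategory) ⟶ ⟨F i, hi⟩) ≠ 0 := by
      intro h
      have hg : g = 0 := congrArg (fun t => t.hom) h
      exact h1 i (by rw [← cancel_epi g, hg, zero_comp, zero_comp])
    exact ⟨i, hi, ⟨@asIso _ _ _ _ _ (isIso_of_hom_simple h0)⟩⟩

end

instance : E.ι.Linear k where
  map_smul _ _ := rfl

/-- For coherent sheaves `hP` is supplied by `IsSimpleIterated.isCoherent`. -/
lemma iteratedExtensions_iff {P : ObjectProperty Z} (hP : ∀ M, IsSimpleIterated F M → P M)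
    (M : Z) : iteratedExtensions P F M ↔ IsSimpleIterated F M :=
  ⟨fun hM => isIteratedExtension_iff.1 hM.2, fun hM => ⟨hP M hM, isIteratedExtension_iff.2 hM⟩⟩

lemma isFinTilde_extSimple {P : ObjectProperty Z} (hF : ∀ i, P (F i))
    (hP : ∀ M, IsSimpleIterated F M → P M) (h : IsSimpleCollection k F)
    (hExt : ∀ i j, FiniteExtOne k (F i) (F j)) : IsFinTilde k (extSimple hF) := by
  have hE := iteratedExtensions_iff hP
  have hA := isAbelianCat_fullSubcategory hE h.isIso_of_ne_zero
  have hfin (M N : (iteratedExtensions P F).FullSubcategory) : Module.Finite k (M.obj ⟶ N.obj) :=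
    ((hE _).1 M.property).finite_hom h.finite_hom ((hE _).1 N.property)
  exact
    { essentiallySmall := essentiallySmall_fullSubcategory hExt _ hE
      isAbelian := hA
      finiteLength := fun M =>
        hasFiniteLength_mk hE h.isIso_of_ne_zero h.id_ne_zero ((hE _).1 M.property) M.property
      finite_hom := fun M N =>
        have : Module.Finite k
            ((iteratedExtensions P F).ι.obj M ⟶ (iteratedExtensions P F).ι.obj N) := hfin M N
        Module.Finite.of_injective ((iteratedExtensions P F).ι.mapLinearMap k)
          (iteratedExtensions P F).ι.map_injective
      finite_ext := by
        let := hA.abelian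
        have := preservesFiniteLimits_ι hE h.isIso_of_ne_zero
        have := preservesFiniteColimits_ι hE h.isIso_of_ne_zero
        exact fun M N => finiteExtOne_of_fullyFaithful k (iteratedExtensions P F).ι
          (((hE _).1 M.property).finiteExtOne hExt ((hE _).1 N.property))
      simple := fun i => simple_mk hE h.isIso_of_ne_zero h.id_ne_zero i _
      injective := fun i j ⟨e⟩ => h.eq_of_iso ((iteratedExtensions P F).ι.mapIso e)
      exhaustive := fun M hM => by
        obtain ⟨i, _, e⟩ := exists_iso_of_simple hE h.isIso_of_ne_zero h.id_ne_zero M hM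
        exact ⟨i, e⟩ }

end Subcategory

/-! ### Recovering a single G_i from the direct sum functor. -/

section SingleSummand

variable (k : Type v) [Field k] {C : Type u} [Category.{v} C] [Preadditive C] [Linear k C]
  [HasFiniteBiproducts C] {n : ℕ}

/-- The `i`-th simple object of `(mod_fd k)^n`. -/
def unitVector (i : Fin n) : (_ : Fin n) → FGModuleCat.{v} k :=
  fun j => FGModuleCat.of k (Fin (if i = j then 1 else 0) → k)

lemma finrank_unitVector (i j : Fin n) :
    Module.finrank k (unitVector k i j) = if i = j then 1 else 0 :=
  Module.finrank_fin_fun k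

/-- The image of the `i`-th simple object of `(mod_fd k)^n` is `G i`. -/
def sumFunctorUnitVectorIso (G : Fin n → C) (i : Fin n) :
    (sumFunctor (k := k) G).obj (unitVector k i) ≅ G i where
  hom := sumProj G _ i ⟨0, by simp [finrank_unitVector]⟩
  inv := sumIncl G _ i ⟨0, by simp [finrank_unitVector]⟩
  hom_inv_id := by
    rw [← sum_total G (unitVector k i), Finset.sum_eq_single i]
    · rw [Finset.sum_eq_single ⟨0, by simp [finrank_unitVector]⟩ _ (by simp)]
      intro a _ ha
      have h := a.2
      simp only [finrank_unitVector, if_true] at h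
      exact (ha (Fin.ext (by simpa using h))).elim
    · intro j _ hj
      refine Finset.sum_eq_zero fun a _ => ?_
      have h := a.2
      simp [finrank_unitVector, hj.symm] at h
    · simp
  inv_hom_id := by rw [sumIncl_proj]; simp

end SingleSummand

/-! ### Deformations as exact functors with an identification T i_A ≅ i₀. -/

section Representability

attribute [local instance] Abelian.hasFiniteBiproducts

variable {k : Type u} [Field k] {n : ℕ}

namespace FinTilde

section

variable {Z : Type (u + 1)} [Category.{u} Z] [Abelian Z] [Linear k Z]
  {P : ObjectProperty Z} {F : Fin n → Z}

namespace DefPair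

variable {A B : FinTilde k n}

lemma flat_naturality {T : A ⥤ Z} (φ : T ⟶ A.reflect ⋙ i₀ k F) {V W : Vect k n} (f : V ⟶ W) :
    T.map (A.incl.map f) ≫ flat φ W = flat φ V ≫ (i₀ k F).map f := by
  have h1 := φ.naturality (A.incl.map f)
  have h2 := A.adj.counit.naturality f
  dsimp at h1 h2
  dsimp [flat]
  rw [reassoc_of% h1, Category.assoc, ← Functor.map_comp, h2, Functor.map_comp]

/-- The identification `T ∘ i_{S(A)} ≅ i₀` given by a deformation `(T, φ)`. -/
def flatIso [IsAlgClosed k] (x : DefPair P F A) : A.incl ⋙ x.T ≅ i₀ k F :=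
  NatIso.ofComponents
    (fun V => @asIso _ _ _ _ (flat x.φ V) ((isIso_iff_flat x.φ).1 x.isIso_φ V))
    (fun f => flat_naturality x.φ f)

/-- The morphism `T ⟶ i₀ ∘ i_{S(A)}^*` adjoint to `T ∘ i_{S(A)} ⟶ i₀`. -/
def sharp {T : A ⥤ Z} (s : A.incl ⋙ T ⟶ i₀ k F) : T ⟶ A.reflect ⋙ i₀ k F where
  app M := T.map (A.adj.unit.app M) ≫ s.app (A.reflect.obj M)
  naturality M N f := by
    have h1 := A.adj.unit.naturality f
    have h2 := s.naturality (A.reflect.map f)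
    dsimp at h1 h2 ⊢
    rw [Category.assoc, ← h2, ← Functor.map_comp_assoc, ← Functor.map_comp_assoc, h1]

lemma flat_sharp {T : A ⥤ Z} (s : A.incl ⋙ T ⟶ i₀ k F) (V : Vect k n) :
    flat (sharp s) V = s.app V := by
  have h := s.naturality (A.adj.counit.app V)
  dsimp at h
  dsimp [flat, sharp]
  rw [Category.assoc, ← h, ← Functor.map_comp_assoc, Adjunction.right_triangle_components,
    CategoryTheory.Functor.map_id, Category.id_comp]

lemma flat_rescale [IsAlgClosed k] (α : i₀ k F ≅ i₀ k F) (x : DefPair P F A) (V : Vect k n) :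
    flat (x.rescale α).φ V = flat x.φ V ≫ α.hom.app V := by
  have h := α.hom.naturality (A.adj.counit.app V)
  dsimp [flat, rescale] at h ⊢
  rw [Category.assoc, Category.assoc, h]

/-- An exact functor sending the simple objects to the `F i` takes values in the iterated
extensions of the `F i`. -/
lemma isSimpleIterated_obj [IsAlgClosed k] (x : DefPair P F A) (M : A) :
    IsSimpleIterated F (x.T.obj M) := by
  have := x.additive
  have := x.preservesFiniteLimits
  have := x.preservesFiniteColimits
  induction A.isFinTilde.finiteLength M with
  | zero h => exact .zero (x.T.map_isZero h)
  | step hS _ h₃ ih =>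
    obtain ⟨i, ⟨e⟩⟩ := A.isFinTilde.exhaustive _ h₃
    -- T sends the simple quotient to F_i, as one sees by evaluating the identification T i_A ≅ i₀
    -- at the i-th unit vector.
    refine (IsSimpleIterated.of_mem i).of_shortExact (hS.map_of_exact x.T) ih ?_
    exact x.T.mapIso (e ≪≫ (sumFunctorUnitVectorIso k A.S i).symm) ≪≫
      x.flatIso.app (unitVector k i) ≪≫ sumFunctorUnitVectorIso k F i

end DefPair

end

/-! ### The universal deformation. -/

section Universal

variable {Z : Type (u + 1)} [Category.{u} Z] [Abelian Z] [Linear k Z]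
  {P : ObjectProperty Z} {F : Fin n → Z} {hF : ∀ i, P (F i)} (h : IsFinTilde k (extSimple hF))

/-- The inclusion of `ℱ({F_i})`. -/
def extInclusion : extCategory k hF h ⥤ Z := (iteratedExtensions P F).ι

instance : (extInclusion h).Full := inferInstanceAs (iteratedExtensions P F).ι.Full
instance : (extInclusion h).Faithful := inferInstanceAs (iteratedExtensions P F).ι.Faithful
instance : (extInclusion h).Additive := inferInstanceAs (iteratedExtensions P F).ι.Additive
instance : (extInclusion h).Linear k where
  map_smul _ _ := rfl

/-- The identification of `i_S` with `i₀` over `ℱ({F_i})`. -/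
def extInclusionIso : (extCategory k hF h).incl ⋙ extInclusion h ≅ i₀ k F :=
  sumFunctorCompIso (extCategory k hF h).S F (extInclusion h) fun _ => Iso.refl _

variable [IsAlgClosed k] [PreservesFiniteLimits (extInclusion h)]
  [PreservesFiniteColimits (extInclusion h)]

/-- The universal deformation: the inclusion of `ℱ({F_i})`. -/
def universalDefPair : DefPair P F (extCategory k hF h) where
  T := extInclusion h
  prop_obj M := ((show (iteratedExtensions P F).FullSubcategory from M).property).1
  additive := inferInstance
  linear := inferInstance
  preservesFiniteLimits := inferInstance
  preservesFiniteColimits := inferInstance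
  φ := DefPair.sharp (extInclusionIso h).hom
  isIso_φ := by
    rw [DefPair.isIso_iff_flat]
    intro V
    rw [DefPair.flat_sharp]
    infer_instance

variable {h} {A : FinTilde k n}

/-- Up to the fixed isomorphism `extInclusionIso`, the identification carried by the pulled back
pair is σ itself. -/
lemma flat_pullback_universal (p : PreHom A (extCategory k hF h)) (V : Vect k n) :
    DefPair.flat ((universalDefPair h).pullback p).φ V =
      (extInclusion h).map (p.σ.hom.app V) ≫ (extInclusionIso h).hom.app V :=
  (DefPair.flat_pullback p _ V).trans (congrArg _ (DefPair.flat_sharp _ V))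

/-- This gives injectivity of η: the isomorphism of functors lifts through the fully faithful
inclusion, and its compatibility with σ can be checked after including. -/
lemma rel_of_pullback_rel {p q : PreHom A (extCategory k hF h)}
    (hpq : ((universalDefPair h).pullback p).Rel ((universalDefPair h).pullback q)) :
    p.Rel q := by
  obtain ⟨γ, hγ⟩ := (DefPair.rel_iff _ _).1 hpq
  refine (PreHom.rel_iff _ _).2 ⟨Functor.fullyFaithfulCancelRight (extInclusion h) γ, fun V => ?_⟩
  refine (extInclusion h).map_injective ?_
  rw [← cancel_mono ((extInclusionIso h).hom.app V), ← flat_pullback_universal p V, ← hγ V,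
    flat_pullback_universal q V, Functor.map_comp, Category.assoc]
  exact congrArg (· ≫ _) ((extInclusion h).map_preimage _)

/-- This gives surjectivity of η: T factors through ℱ on the nose, and σ is the lift of its
identification with i₀. -/
lemma exists_pullback_rel (x : DefPair P F A) (hP : ∀ M, IsSimpleIterated F M → P M) :
    ∃ p : PreHom A (extCategory k hF h), ((universalDefPair h).pullback p).Rel x := by
  have hx (M : A) : iteratedExtensions P F (x.T.obj M) :=
    ⟨hP _ (x.isSimpleIterated_obj M), isIteratedExtension_iff.2 (x.isSimpleIterated_obj M)⟩
  let L : A ⥤ extCategory k hF h := (iteratedExtensions P F).lift x.T hx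
  let p : PreHom A (extCategory k hF h) :=
    { functor := L
      additive := ⟨fun {M N f g} => (extInclusion h).map_injective (x.additive.map_add)⟩
      linear := ⟨fun {M N} f r => (extInclusion h).map_injective (x.linear.map_smul f r)⟩
      -- The lift followed by the inclusion is T, and a fully faithful inclusion reflects limits;
      -- colimits are treated in the same way.
      preservesFiniteLimits := by
        have : PreservesFiniteLimits (L ⋙ extInclusion h) := x.preservesFiniteLimits
        exact preservesFiniteLimits_of_reflects_of_preserves L (extInclusion h)
      preservesFiniteColimits := by
        have : PreservesFiniteColimits (L ⋙ extInclusion h) := x.preservesFiniteColimits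
        exact preservesFiniteColimits_of_reflects_of_preserves L (extInclusion h)
      σ := Functor.fullyFaithfulCancelRight (extInclusion h)
        (show (A.incl ⋙ L) ⋙ extInclusion h ≅ _ from x.flatIso ≪≫ (extInclusionIso h).symm) }
  refine ⟨p, (DefPair.rel_iff _ _).2 ⟨Iso.refl _, fun V => ?_⟩⟩
  refine (Category.id_comp _).trans (Eq.trans ?_ (flat_pullback_universal p V).symm)
  have : (extInclusion h).map (p.σ.hom.app V) =
      DefPair.flat x.φ V ≫ (extInclusionIso h).inv.app V :=
    (extInclusion h).map_preimage _
  rw [this]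
  exact ((Category.assoc _ _ _).trans ((congrArg (DefPair.flat x.φ V ≫ ·)
    ((extInclusionIso h).inv_hom_id_app V)).trans (Category.comp_id _))).symm

/-- An isomorphism θ need not respect the identifications; its defect q.σ⁻¹ θ⁻¹ p.σ is an
automorphism of i_ℱ, and α is its transport to i₀. Conversely, whatever α is, the underlying
isomorphism lifts through the inclusion. -/
lemma nonempty_iso_iff_exists_rescale (p q : PreHom A (extCategory k hF h)) :
    Nonempty (p.functor ≅ q.functor) ↔ ∃ α : i₀ k F ≅ i₀ k F,
      ((universalDefPair h).pullback p).Rel (((universalDefPair h).pullback q).rescale α) := by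
  refine ⟨fun ⟨θ⟩ => ?_, fun ⟨α, γ, _⟩ => ?_⟩
  · let c := extInclusionIso h
    let s : (extCategory k hF h).incl ≅ (extCategory k hF h).incl :=
      q.σ.symm ≪≫ Functor.isoWhiskerLeft A.incl θ.symm ≪≫ p.σ
    refine ⟨c.symm ≪≫ Functor.isoWhiskerRight s (extInclusion h) ≪≫ c, (DefPair.rel_iff _ _).2
      ⟨Functor.isoWhiskerRight θ (extInclusion h), fun V => ?_⟩⟩
    refine (congrArg (_ ≫ ·) ((DefPair.flat_rescale _ _ V).trans
      (congrArg (· ≫ _) (flat_pullback_universal q V)))).trans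
        (Eq.trans ?_ (flat_pullback_universal p V).symm)
    have key : (extInclusion h).map (θ.hom.app (A.incl.obj V)) ≫
        ((extInclusion h).map (q.σ.hom.app V) ≫ c.hom.app V) ≫
          c.inv.app V ≫ (extInclusion h).map (q.σ.inv.app V ≫ θ.inv.app (A.incl.obj V) ≫
            p.σ.hom.app V) ≫ c.hom.app V =
        (extInclusion h).map (p.σ.hom.app V) ≫ c.hom.app V := by
      rw [Category.assoc, Iso.hom_inv_id_app_assoc, ← Functor.map_comp_assoc,
        ← Functor.map_comp_assoc]
      refine congrArg (fun t => (extInclusion h).map t ≫ c.hom.app V) ?_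
      exact (Category.assoc _ _ _).trans ((congrArg (θ.hom.app (A.incl.obj V) ≫ ·)
        (q.σ.hom_inv_id_app_assoc V _)).trans (θ.hom_inv_id_app_assoc (A.incl.obj V) _))
    exact key
  · exact ⟨Functor.fullyFaithfulCancelRight (extInclusion h) γ⟩

/-- `ℱ({F_i})` represents the deformation functor. -/
lemma exists_representation (hP : ∀ M, IsSimpleIterated F M → P M) :
    ∃ η : yoneda.obj (extCategory k hF h) ≅ ncDef (k := k) P F,
      ∀ (A : FinTilde k n) (p q : PreHom A (extCategory k hF h)),
        Nonempty (p.functor ≅ q.functor) ↔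
          ∃ α : i₀ k F ≅ i₀ k F,
            η.hom.app (Opposite.op A) p.toHom =
              FinTilde.rescale α (η.hom.app (Opposite.op A) q.toHom) := by
  -- By Yoneda, η is pullback of the universal pair, so naturality is automatic and only bijectivity
  -- is left.
  let η : yoneda.obj (extCategory k hF h) ⟶ ncDef (k := k) P F :=
    yonedaEquiv.symm (Quotient.mk (DefPair.setoid P F _) (universalDefPair h))
  have hη (A : FinTilde k n) (p : PreHom A (extCategory k hF h)) :
      η.app (Opposite.op A) p.toHom =
        Quotient.mk (DefPair.setoid P F A) ((universalDefPair h).pullback p) :=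
    rfl
  have : IsIso η := by
    rw [NatTrans.isIso_iff_isIso_app]
    intro A
    rw [isIso_iff_bijective]
    constructor
    · intro f g
      induction f using Quotient.inductionOn with
      | h p =>
      induction g using Quotient.inductionOn with
      | h q =>
        intro hpq
        exact Quotient.sound (rel_of_pullback_rel
          (Quotient.exact (((hη A.unop p).symm.trans hpq).trans (hη A.unop q))))
    · intro x
      induction x using Quotient.inductionOn with
      | h x =>
        obtain ⟨p, hp⟩ := exists_pullback_rel (h := h) x hP
        exact ⟨p.toHom, (hη A.unop p).trans (Quotient.sound hp)⟩
  refine ⟨asIso η, fun A p q => (nonempty_iso_iff_exists_rescale p q).trans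
    (exists_congr fun α => ?_)⟩
  rw [asIso_hom, hη, hη]
  exact ⟨fun hr => Quotient.sound hr, fun hr => Quotient.exact hr⟩

end Universal

end FinTilde

end Representability

/-! ### Epimorphisms of sheaves of modules. -/

section SheafOfModulesEpi

universe v' u' u₁

variable {C : Type u'} [Category.{v'} C] {J : GrothendieckTopology C} (R : Sheaf J RingCat.{u₁})
  [HasSheafify J AddCommGrpCat.{v}] [J.WEqualsLocallyBijective AddCommGrpCat.{v}]

/-- An epimorphism of sheaves of modules is an epimorphism of sheaves of abelian groups. -/
lemma epi_toSheaf_map {M N : SheafOfModules.{v} R} (g : M ⟶ N) [Epi g] :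
    Epi ((SheafOfModules.toSheaf.{v} R).map g) := by
  let L := PresheafOfModules.sheafification.{v} (𝟙 R.obj)
  let G := SheafOfModules.forget.{v} R ⋙ PresheafOfModules.restrictScalars (𝟙 R.obj)
  let adj : L ⊣ G := PresheafOfModules.sheafificationAdjunction.{v} (𝟙 R.obj)
  have hn : L.map (G.map g) ≫ adj.counit.app N = adj.counit.app M ≫ g := adj.counit.naturality g
  have hiso (N' : SheafOfModules.{v} R) : IsIso (adj.counit.app N') := inferInstance
  -- The counit is invertible, so g is the sheafification of its underlying presheaf map. Factor
  -- that map through its presheaf image: the inclusion of the image becomes both mono and epi,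
  -- hence invertible, after sheafification, while the surjection onto the image stays an
  -- epimorphism of abelian sheaves.
  have h1 : Epi (L.map (G.map g)) := by
    have : L.map (G.map g) = adj.counit.app M ≫ g ≫ inv (adj.counit.app N) := by
      rw [← reassoc_of% hn, IsIso.hom_inv_id, Category.comp_id]
    rw [this]
    infer_instance
  have h2 : L.map (factorThruImage (G.map g)) ≫ L.map (image.ι (G.map g)) = L.map (G.map g) := by
    rw [← L.map_comp, image.fac]
  have h3 : Epi (L.map (image.ι (G.map g))) := by
    rw [← h2] at h1
    exact epi_of_epi (L.map (factorThruImage (G.map g))) _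
  have h4 : IsIso (L.map (image.ι (G.map g))) := isIso_of_mono_of_epi _
  have h5 : Epi ((SheafOfModules.toSheaf.{v} R).map (L.map (factorThruImage (G.map g)))) :=
    inferInstanceAs (Epi ((presheafToSheaf J AddCommGrpCat).map
      ((PresheafOfModules.toPresheaf R.obj).map (factorThruImage (G.map g)))))
  have h6 : Epi ((SheafOfModules.toSheaf.{v} R).map (adj.counit.app M ≫ g)) := by
    rw [← hn, ← h2, Functor.map_comp, Functor.map_comp]
    infer_instance
  rw [Functor.map_comp] at h6
  exact epi_of_epi ((SheafOfModules.toSheaf.{v} R).map (adj.counit.app M)) _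

end SheafOfModulesEpi

/-! ### Extensions of coherent modules. -/

section CoherentExtensions

open AlgebraicGeometry

variable {X : Scheme.{u}}

/-- An epimorphism of `𝒪_X`-modules is locally surjective on sections. -/
lemma exists_local_lift {M N : X.Modules} (g : M ⟶ N) [Epi g] {U : X.Opens} (t : Γ(N, U))
    {x : X} (hx : x ∈ U) :
    ∃ (V : X.Opens) (hVU : V ≤ U), x ∈ V ∧ ∃ s : Γ(M, V), g.app V s = res N hVU t := by
  have h0 : Epi (C := SheafOfModules X.ringCatSheaf) (X := M) (Y := N) g :=
    ⟨fun {K} a b h => Epi.left_cancellation (C := X.Modules) (f := g) (Z := K) a b h⟩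
  have h1 : Epi ((SheafOfModules.toSheaf X.ringCatSheaf).map g) :=
    epi_toSheaf_map X.ringCatSheaf (M := M) (N := N) g
  have h2 := (TopCat.Sheaf.isLocallySurjective_iff_epi _).2 h1
  obtain ⟨V, i, ⟨s, hs⟩, hV⟩ := (TopCat.Presheaf.isLocallySurjective_iff _).1 h2 U t x hx
  exact ⟨V, i, hV, s, hs⟩

/-- Taking sections over `U`. -/
abbrev sections (U : X.Opens) : X.Modules ⥤ Ab :=
  Scheme.Modules.toPresheaf X ⋙ (evaluation _ _).obj (.op U)

instance (U : X.Opens) : PreservesFiniteLimits (sections U) :=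
  have : PreservesFiniteLimits
      ((evaluation (TopologicalSpace.Opens X)ᵒᵖ Ab.{u}).obj (Opposite.op U)) :=
    ⟨fun _ _ _ => inferInstance⟩
  comp_preservesFiniteLimits _ _

instance (U : X.Opens) : (sections U).PreservesZeroMorphisms where
  map_zero _ _ := rfl

lemma app_injective {M N : X.Modules} (f : M ⟶ N) [Mono f] (U : X.Opens) :
    Function.Injective (f.app U) :=
  (AddCommGrpCat.mono_iff_injective _).1 (inferInstanceAs (Mono ((sections U).map f)))

/-- Sections are left exact, so no shrinking of U is needed here, unlike for lifts along the
epimorphism. -/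
lemma exists_app_eq {S : ShortComplex X.Modules} (hS : S.ShortExact) {U : X.Opens}
    (s : Γ(S.X₂, U)) (hs : S.g.app U s = 0) : ∃ r : Γ(S.X₁, U), S.f.app U r = s := by
  have := hS.mono_f
  have h : (S.map (sections U)).Exact := hS.exact.map_of_mono_of_preservesKernel _ this inferInstance
  exact (ShortComplex.ab_exact_iff _).1 h s hs

lemma app_res {M N : X.Modules} (f : M ⟶ N) {U V : X.Opens} (h : U ≤ V) (s : Γ(M, V)) :
    f.app U (res M h s) = res N h (f.app V s) :=
  ConcreteCategory.congr_hom (f.mapPresheaf.naturality (homOfLE h).op) s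

lemma res_res (M : X.Modules) {U V W : X.Opens} (h : U ≤ V) (h' : V ≤ W) (s : Γ(M, W)) :
    res M h (res M h' s) = res M (h.trans h') s := by
  rw [res, res, ← ConcreteCategory.comp_apply, ← Functor.map_comp]
  rfl

/-- The restriction of a function. -/
abbrev resFun {U V : X.Opens} (h : U ≤ V) (a : Γ(X, V)) : Γ(X, U) :=
  X.presheaf.map (homOfLE h).op a

lemma resFun_resFun {U V W : X.Opens} (h : U ≤ V) (h' : V ≤ W) (a : Γ(X, W)) :
    resFun h (resFun h' a) = resFun (h.trans h') a := by
  rw [resFun, resFun, ← ConcreteCategory.comp_apply, ← Functor.map_comp]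
  rfl

lemma res_add (M : X.Modules) {U V : X.Opens} (h : U ≤ V) (s t : Γ(M, V)) :
    res M h (s + t) = res M h s + res M h t :=
  map_add _ _ _

lemma res_smul (M : X.Modules) {U V : X.Opens} (h : U ≤ V) (a : Γ(X, V)) (s : Γ(M, V)) :
    res M h (a • s) = resFun h a • res M h s :=
  M.map_smul (homOfLE h) a s

lemma res_sum_smul (M : X.Modules) {U V : X.Opens} (h : U ≤ V) {m : ℕ} (a : Fin m → Γ(X, V))
    (s : Fin m → Γ(M, V)) :
    res M h (∑ i, a i • s i) = ∑ i, resFun h (a i) • res M h (s i) := by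
  rw [res, map_sum]
  exact Finset.sum_congr rfl fun i _ => res_smul M h _ _

lemma app_sum_smul {M N : X.Modules} (f : M ⟶ N) {U : X.Opens} {m : ℕ} (a : Fin m → Γ(X, U))
    (s : Fin m → Γ(M, U)) : f.app U (∑ i, a i • s i) = ∑ i, a i • f.app U (s i) := by
  rw [map_sum]
  exact Finset.sum_congr rfl fun i _ => f.app_smul _ _

lemma exists_open_forall {U : X.Opens} {x : X} (hx : x ∈ U) {m : ℕ} (Q : Fin m → X.Opens → Prop)
    (hQ : ∀ i (V W : X.Opens), W ≤ V → Q i V → Q i W)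
    (h : ∀ i, ∃ V ≤ U, x ∈ V ∧ Q i V) : ∃ V ≤ U, x ∈ V ∧ ∀ i, Q i V := by
  induction m with
  | zero => exact ⟨U, le_rfl, hx, fun i => i.elim0⟩
  | succ m ih =>
    obtain ⟨V, hVU, hV, hV'⟩ := ih (fun i => Q i.succ) (fun i => hQ _) fun i => h _
    obtain ⟨W, hWU, hW, hW'⟩ := h 0
    refine ⟨V ⊓ W, inf_le_left.trans hVU, ⟨hV, hW⟩, fun i => ?_⟩
    refine Fin.cases ?_ (fun i => ?_) i
    · exact hQ _ _ _ inf_le_right hW'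
    · exact hQ _ _ _ inf_le_left (hV' i)

lemma exists_local_lifts {M N : X.Modules} (g : M ⟶ N) [Epi g] {U : X.Opens} {m : ℕ}
    (t : Fin m → Γ(N, U)) {x : X} (hx : x ∈ U) :
    ∃ (V : X.Opens) (hVU : V ≤ U), x ∈ V ∧ ∃ s : Fin m → Γ(M, V),
      ∀ i, g.app V (s i) = res N hVU (t i) := by
  obtain ⟨V, hVU, hV, h⟩ := exists_open_forall hx
    (fun i V => ∃ (hVU : V ≤ U) (s : Γ(M, V)), g.app V s = res N hVU (t i))
    (fun i V W hWV ⟨hVU, s, hs⟩ => ⟨hWV.trans hVU, res M hWV s, by rw [app_res, hs, res_res]⟩)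
    fun i => by
      obtain ⟨V, hVU, hV, s, hs⟩ := exists_local_lift g (t i) hx
      exact ⟨V, hVU, hV, hVU, s, hs⟩
  choose _ s hs using h
  exact ⟨V, hVU, hV, s, hs⟩

lemma IsCoherent.of_isZero {M : X.Modules} (hM : IsZero M) : IsCoherent M := by
  have h0 {U : X.Opens} (s : Γ(M, U)) : s = 0 := by
    have h : (𝟙 M : M ⟶ M).app U s = (0 : M ⟶ M).app U s := by rw [hM.eq_of_src (𝟙 M) 0]
    exact h
  -- No generators are needed, and every tuple is a relation, so the rows of the identity matrix
  -- generate the relations.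
  refine ⟨fun x => ⟨⊤, trivial, 0, Fin.elim0, fun V hV t y hy => ⟨V, le_rfl, hy, Fin.elim0, ?_⟩⟩,
    fun U m s x hx => ⟨U, le_rfl, hx, m, fun j i => if i = j then 1 else 0, fun j => h0 _,
      fun W hW t _ y hy => ⟨W, le_rfl, hy, t, fun i => ?_⟩⟩⟩
  · rw [h0 (res M _ t)]
    simp
  · rw [Finset.sum_eq_single i]
    · simp
    · intro j _ hj
      simp [hj.symm]
    · simp

/-- Generators are those of the submodule together with local lifts of those of the quotient. -/
lemma finiteType_of_shortExact {S : ShortComplex X.Modules} (hS : S.ShortExact)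
    (h₁ : IsCoherent S.X₁) (h₃ : IsCoherent S.X₃) (x : X) :
    ∃ (U : X.Opens), x ∈ U ∧ ∃ (m : ℕ) (s : Fin m → Γ(S.X₂, U)),
      ∀ (V : X.Opens) (hVU : V ≤ U) (t : Γ(S.X₂, V)), ∀ y ∈ V, ∃ (W : X.Opens) (hWV : W ≤ V),
        y ∈ W ∧ ∃ c : Fin m → Γ(X, W),
          res S.X₂ hWV t = ∑ i, c i • res S.X₂ (hWV.trans hVU) (s i) := by
  have := hS.epi_g
  obtain ⟨U₃, hx₃, m₃, s₃, hs₃⟩ := h₃.finiteType x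
  obtain ⟨U₁, hx₁, m₁, s₁, hs₁⟩ := h₁.finiteType x
  obtain ⟨U₂, hU₂, hx₂, b, hb⟩ := exists_local_lifts S.g s₃ hx₃
  refine ⟨U₁ ⊓ U₂, ⟨hx₁, hx₂⟩, m₁ + m₃, Fin.append
    (fun j => S.f.app _ (res S.X₁ inf_le_left (s₁ j))) (fun i => res S.X₂ inf_le_right (b i)),
    fun V hV t y hy => ?_⟩
  obtain ⟨W₁, hW₁, hy₁, c, hc⟩ :=
    hs₃ V (hV.trans (inf_le_right.trans hU₂)) (S.g.app V t) y hy
  -- Subtracting the combination of lifts with the same image in the quotient leaves a section of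
  -- the submodule.
  obtain ⟨a, ha⟩ := exists_app_eq hS (U := W₁) (res S.X₂ hW₁ t -
      ∑ i, c i • res S.X₂ (hW₁.trans (hV.trans inf_le_right)) (b i)) (by
    rw [map_sub, app_res, hc, app_sum_smul, sub_eq_zero]
    refine Finset.sum_congr rfl fun i _ => ?_
    rw [app_res, hb, res_res])
  obtain ⟨W, hW, hyW, d, hd⟩ := hs₁ W₁ (hW₁.trans (hV.trans inf_le_left)) a y hy₁
  refine ⟨W, hW.trans hW₁, hyW, Fin.append d fun i => resFun hW (c i), ?_⟩
  have ht := congrArg (res S.X₂ hW) (eq_add_of_sub_eq ha.symm)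
  rw [res_res, res_add, ← app_res, hd, app_sum_smul, res_sum_smul] at ht
  rw [ht, Fin.sum_univ_add]
  simp only [Fin.append_left, Fin.append_right, ← app_res, res_res]

/-- Let r generate the relations among the images of the s_i in the quotient. Each r_j evaluates on
s to a section a_j of the submodule; if q generates the relations among the a_j, the product matrix
q r generates those among the s_i. -/
lemma relations_of_shortExact {S : ShortComplex X.Modules} (hS : S.ShortExact)
    (h₁ : IsCoherent S.X₁) (h₃ : IsCoherent S.X₃) (U : X.Opens) (m : ℕ)
    (s : Fin m → Γ(S.X₂, U)) (x : X) (hx : x ∈ U) :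
    ∃ (V : X.Opens) (hVU : V ≤ U), x ∈ V ∧ ∃ (l : ℕ) (r : Fin l → Fin m → Γ(X, V)),
      (∀ j, ∑ i, r j i • res S.X₂ hVU (s i) = 0) ∧
      ∀ (W : X.Opens) (hWV : W ≤ V) (t : Fin m → Γ(X, W)),
        ∑ i, t i • res S.X₂ (hWV.trans hVU) (s i) = 0 → ∀ y ∈ W, ∃ (W' : X.Opens) (hW : W' ≤ W),
          y ∈ W' ∧ ∃ c : Fin l → Γ(X, W'), ∀ i, resFun hW (t i) =
            ∑ j, c j * resFun (hW.trans hWV) (r j i) := by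
  have := hS.mono_f
  obtain ⟨V, hVU, hxV, l, r, hr, hr'⟩ := h₃.relations U m (fun i => S.g.app U (s i)) x hx
  have hu (j : Fin l) : ∃ u : Γ(S.X₁, V), S.f.app V u = ∑ i, r j i • res S.X₂ hVU (s i) := by
    refine exists_app_eq hS _ ?_
    rw [app_sum_smul, ← hr j]
    exact Finset.sum_congr rfl fun i _ => by rw [app_res]
  choose a ha using hu
  obtain ⟨V', hV', hxV', p, q, hq, hq'⟩ := h₁.relations V l a x hxV
  have hfa {W : X.Opens} (hW : W ≤ V) (c : Fin l → Γ(X, W)) :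
      S.f.app W (∑ j, c j • res S.X₁ hW (a j)) =
        ∑ i, (∑ j, c j * resFun hW (r j i)) • res S.X₂ (hW.trans hVU) (s i) := by
    rw [app_sum_smul]
    simp only [app_res, ha, res_sum_smul, res_res, Finset.smul_sum, Finset.sum_smul, smul_smul]
    exact Finset.sum_comm
  refine ⟨V', hV'.trans hVU, hxV', p, fun e i => ∑ j, q e j * resFun hV' (r j i), fun e => ?_,
    fun W hW t ht y hy => ?_⟩
  · rw [← hfa, hq, map_zero]
  · obtain ⟨W₁, hW₁, hy₁, c, hc⟩ := hr' W (hW.trans hV') t (by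
      have h := congrArg (S.g.app W) ht
      rw [app_sum_smul, map_zero] at h
      rw [← h]
      exact Finset.sum_congr rfl fun i _ => by rw [app_res]) y hy
    -- Since t = c r, the combination ∑ c_j a_j maps to ∑ t_i s_i = 0, and the submodule injects on
    -- sections. Thus c is a relation among the a_j, hence locally c = d q and t = d (q r).
    have hc0 : ∑ j, c j • res S.X₁ ((hW₁.trans hW).trans hV') (a j) = 0 := by
      refine app_injective S.f W₁ ?_
      rw [hfa, map_zero]
      have h := congrArg (res S.X₂ hW₁) ht
      rw [res_sum_smul, res, map_zero] at h
      rw [← h]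
      refine Finset.sum_congr rfl fun i _ => ?_
      rw [res_res]
      exact congrArg (· • _) (hc i).symm
    obtain ⟨W₂, hW₂, hy₂, d, hd⟩ := hq' W₁ (hW₁.trans hW) c hc0 y hy₁
    refine ⟨W₂, hW₂.trans hW₁, hy₂, d, fun i => ?_⟩
    have h1 : resFun (hW₂.trans hW₁) (t i) = ∑ j, resFun hW₂ (c j) *
        resFun ((hW₂.trans hW₁).trans (hW.trans hV')) (r j i) := by
      rw [← resFun_resFun hW₂ hW₁]
      refine (congrArg (resFun hW₂) (hc i)).trans ?_
      simp only [map_sum, map_mul]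
      exact Finset.sum_congr rfl fun j _ => congrArg (_ * ·) (resFun_resFun _ _ _)
    have h2 (j : Fin l) : resFun hW₂ (c j) =
      ∑ e, d e * resFun (hW₂.trans (hW₁.trans hW)) (q e j) := hd j
    have h3 (e : Fin p) : resFun ((hW₂.trans hW₁).trans hW) (∑ j, q e j * resFun hV' (r j i)) =
        ∑ j, resFun (hW₂.trans (hW₁.trans hW)) (q e j) *
          resFun ((hW₂.trans hW₁).trans (hW.trans hV')) (r j i) := by
      simp only [map_sum, map_mul]
      exact Finset.sum_congr rfl fun j _ => congrArg (_ * ·) (resFun_resFun _ _ _)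
    simp only [h1, h2, h3, Finset.sum_mul, Finset.mul_sum, mul_assoc]
    exact Finset.sum_comm

/-- Extensions of coherent modules are coherent. -/
lemma IsCoherent.of_shortExact {S : ShortComplex X.Modules} (hS : S.ShortExact)
    (h₁ : IsCoherent S.X₁) (h₃ : IsCoherent S.X₃) : IsCoherent S.X₂ :=
  ⟨finiteType_of_shortExact hS h₁ h₃, relations_of_shortExact hS h₁ h₃⟩

lemma IsSimpleIterated.isCoherent {n : ℕ} {F : Fin n → X.Modules} (hF : ∀ i, IsCoherent (F i))
    {M : X.Modules} (hM : IsSimpleIterated F M) : IsCoherent M := by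
  induction hM with
  | zero h => exact .of_isZero h
  | @step M i g _ _ ih =>
    exact .of_shortExact (S := ShortComplex.mk (kernel.ι g) g (kernel.condition g))
      (.mk' (ShortComplex.exact_kernel g) inferInstance inferInstance) ih (hF i)

end CoherentExtensions

end

end NCDef

theorem theorem9p10 {k : Type u} [Field k] [IsAlgClosed k] (X : Scheme.{u})
    [X.Over (Spec (CommRingCat.of k))] {n : ℕ} (F : Fin n → X.Modules)
    (hcoh : ∀ i, isCoherent X (F i)) (hF : IsSimpleCollection k F)
    (hExt : ∀ i j, FiniteExtOne k (F i) (F j)) :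
    ∃ (h : IsFinTilde k (extSimple hcoh))
      (η : yoneda.obj (extCategory k hcoh h) ≅ FinTilde.ncDef (k := k) (isCoherent X) F),
      ∀ (A : FinTilde k n) (p q : FinTilde.PreHom A (extCategory k hcoh h)),
        Nonempty (p.functor ≅ q.functor) ↔
          ∃ α : FinTilde.i₀ k F ≅ FinTilde.i₀ k F,
            η.hom.app (Opposite.op A) p.toHom =
              FinTilde.rescale α (η.hom.app (Opposite.op A) q.toHom) := by
  have hP (M : X.Modules) (hM : IsSimpleIterated F M) : isCoherent X M := hM.isCoherent hcoh
  have h := isFinTilde_extSimple hcoh hP hF hExt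
  have hE (M : X.Modules) : iteratedExtensions (isCoherent X) F M ↔ IsSimpleIterated F M :=
    iteratedExtensions_iff hP M
  have : PreservesFiniteLimits (FinTilde.extInclusion h) :=
    preservesFiniteLimits_ι hE hF.isIso_of_ne_zero
  have : PreservesFiniteColimits (FinTilde.extInclusion h) :=
    preservesFiniteColimits_ι hE hF.isIso_of_ne_zero
  exact ⟨h, FinTilde.exists_representation hP⟩
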